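/- **Theorem (deterministic equivalent).** Let $K\in\mathbb N$ be fixed, and let $p=p(n)$ be positive integers with $c_n:=p/n\to c\in(0,\infty)$ as $n\to\infty$. For each $n$ and $r\in\{1,\dots,K\}$ let $A_n^{(r)}\in\mathbb C^{p\times p}$ and $B_n^{(r)}\in\mathbb C^{n\times n}$ be deterministic positive semidefinite matrices, with every $B_n^{(r)}$ diagonal, and let $Z_n^{(r)}=(z_{ij}^{(r)})$ be random $p\times n$ complex matrices, all defined on one probability space. Assume: - (A1) there is $\tau>0$ such that $\|A_n^{(r)}\|_{op}\le\tau$ and $\|B_n^{(r)}\|_{op}\le\tau$ for all $n$ and $r$; - (A2) for each $n$ the entries $z_{ij}^{(r)}$ ($r\le K$, $i\le p$, $j\le n$) of $Z_n^{(1)},\dots,Z_n^{(K)}$ are independent, with $\mathbb E z_{ij}^{(r)}=0$, $\mathbb E|z_{ij}^{(r)}|^2=1$, and $|z_{ij}^{(r)}|\le n^a$ almost surely, where $\frac1{4+\eta_0}<a<\frac14$ for some $\eta_0>0$ (with $a$, $\eta_0$ not depending on $n,r,i,j$). Put $X_n=\sum_{r=1}^K (A_n^{(r)})^{1/2}Z_n^{(r)}(B_n^{(r)})^{1/2}$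 and $S_n=\frac1n X_nX_n^*$ and, for $z\in\mathbb C$ with $\Im z>0$, $$Q(z)=(S_n-zI_p)^{-1},\qquad h_{rn}(z)=\tfrac1p\operatorname{tr}\{A_n^{(r)}Q(z)\},$$ $$\bar Q(z)=\Big(-zI_p+\sum_{r=1}^K\Big(\tfrac1n\operatorname{tr}\Big\{B_n^{(r)}\Big[I_n+c_n\sum_{s=1}^K\mathbb E h_{sn}(z)\,B_n^{(s)}\Big]^{-1}\Big\}\Big)A_n^{(r)}\Big)^{-1}.$$ Then for every $z$ with $\Im z>0$ all these inverses and expectations exist, and $\bar Q(z)$ is a deterministic equivalent of $Q(z)$: for every sequence of deterministic matrices $M_n\in\mathbb C^{p\times p}$ with $\sup_n\|M_n\|_{op}<\infty$, $$\tfrac1p\operatorname{tr}\{(Q(z)-\bar Q(z))M_n\}\longrightarrow 0\quad\text{almost surely as }n\to\infty.$$ -/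

import Mathlib

open MeasureTheory ProbabilityTheory Filter Topology
open scoped ComplexOrder MatrixOrder Matrix.Norms.L2Operator

noncomputable section

namespace SumSeparable

variable {Ω : Type*} [MeasurableSpace Ω] {K p n : ℕ}

/-- The data matrix `X = ∑ᵣ Aᵣ^{1/2} Zᵣ Bᵣ^{1/2}`, with positive semidefinite square roots. -/
def dataMatrix (A : Fin K → Matrix (Fin p) (Fin p) ℂ) (B : Fin K → Matrix (Fin n) (Fin n) ℂ)
    (Z : Fin K → Matrix (Fin p) (Fin n) ℂ) : Matrix (Fin p) (Fin n) ℂ :=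
  ∑ r, CFC.sqrt (A r) * Z r * CFC.sqrt (B r)

/-- The sample covariance matrix `S = (1/n) X X*`. -/
def sampleCov (A : Fin K → Matrix (Fin p) (Fin p) ℂ) (B : Fin K → Matrix (Fin n) (Fin n) ℂ)
    (Z : Fin K → Matrix (Fin p) (Fin n) ℂ) : Matrix (Fin p) (Fin p) ℂ :=
  (1 / (n : ℂ)) • (dataMatrix A B Z * (dataMatrix A B Z).conjTranspose)

/-- The resolvent `Q(z) = (S - z I)⁻¹`. -/
def resolvent (A : Fin K → Matrix (Fin p) (Fin p) ℂ) (B : Fin K → Matrix (Fin n) (Fin n) ℂ)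
    (Z : Fin K → Matrix (Fin p) (Fin n) ℂ) (z : ℂ) : Matrix (Fin p) (Fin p) ℂ :=
  (sampleCov A B Z - z • (1 : Matrix (Fin p) (Fin p) ℂ))⁻¹

/-- `h_r(z) = (1/p) tr (A_r Q(z))`. -/
def hStat (A : Fin K → Matrix (Fin p) (Fin p) ℂ) (B : Fin K → Matrix (Fin n) (Fin n) ℂ)
    (Z : Fin K → Matrix (Fin p) (Fin n) ℂ) (z : ℂ) (r : Fin K) : ℂ :=
  (1 / (p : ℂ)) * (A r * resolvent A B Z z).trace

/-- The `n × n` matrix `I + c ∑ₛ E[h_s(z)] B_s`, with `c = p / n`. -/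
def innerMatrix (μ : Measure Ω) (A : Fin K → Matrix (Fin p) (Fin p) ℂ)
    (B : Fin K → Matrix (Fin n) (Fin n) ℂ) (Z : Fin K → Ω → Matrix (Fin p) (Fin n) ℂ) (z : ℂ) :
    Matrix (Fin n) (Fin n) ℂ :=
  1 + ((p : ℂ) / (n : ℂ)) • ∑ s, (∫ ω, hStat A B (fun r => Z r ω) z s ∂μ) • B s

/-- The `p × p` matrix `-z I + ∑ᵣ (1/n) tr (B_r [I + c ∑ₛ E[h_s(z)] B_s]⁻¹) A_r`. -/
def outerMatrix (μ : Measure Ω) (A : Fin K → Matrix (Fin p) (Fin p) ℂ)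
    (B : Fin K → Matrix (Fin n) (Fin n) ℂ) (Z : Fin K → Ω → Matrix (Fin p) (Fin n) ℂ) (z : ℂ) :
    Matrix (Fin p) (Fin p) ℂ :=
  -(z • (1 : Matrix (Fin p) (Fin p) ℂ)) +
    ∑ r, ((1 / (n : ℂ)) * (B r * (innerMatrix μ A B Z z)⁻¹).trace) • A r

/-- The deterministic matrix `Q̄(z)`, the inverse of `outerMatrix`. -/
def Qbar (μ : Measure Ω) (A : Fin K → Matrix (Fin p) (Fin p) ℂ)
    (B : Fin K → Matrix (Fin n) (Fin n) ℂ) (Z : Fin K → Ω → Matrix (Fin p) (Fin n) ℂ) (z : ℂ) :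
    Matrix (Fin p) (Fin p) ℂ :=
  (outerMatrix μ A B Z z)⁻¹

/-- A sequence of deterministic matrices `D n` is a deterministic equivalent of a sequence of
random matrices `R n`: for every sequence of deterministic matrices `M n` with uniformly bounded
operator norm, `(1/p) tr ((R n - D n) M n) → 0` almost surely. -/
def IsDeterministicEquivalent (μ : Measure Ω) {p : ℕ → ℕ}
    (R : (n : ℕ) → Ω → Matrix (Fin (p n)) (Fin (p n)) ℂ)
    (D : (n : ℕ) → Matrix (Fin (p n)) (Fin (p n)) ℂ) : Prop :=
  ∀ M : (n : ℕ) → Matrix (Fin (p n)) (Fin (p n)) ℂ, (∃ C : ℝ, ∀ n, ‖M n‖ ≤ C) →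
    ∀ᵐ ω ∂μ, Tendsto (fun n => (1 / (p n : ℂ)) * ((R n ω - D n) * M n).trace) atTop (𝓝 0)

end SumSeparable

end

set_option linter.unusedSectionVars false

noncomputable section

namespace SumSeparable

/-! Because the `B r` are diagonal, column `j` of the data matrix is `mixing A B j` applied to the
stacked vector of all noise entries of column index `j`. The columns `x_j` are therefore
independent, with covariance `Γ_j = ∑ r, B r j j • A r`. The error `tr((Q - Q̄)M)/p` is split into a
fluctuation and a bias.

Fluctuation. Deleting a column perturbs `S` by a rank-one matrix, which moves `tr(QM)` by at most
`2‖M‖ / Im z`. The Efron–Stein inequality, applied to the trace and then to its squared deviation,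
bounds the fourth central moment by `O(n²)` (`fourth_moment_le_of_bounded_differences`). Division by
`p⁴ ≍ n⁴` leaves a summable sequence, hence almost sure convergence, whatever the dependence between
different `n` (`ae_tendsto_zero_of_summable`).

Bias. Let `Q_(j)` be the resolvent without column `j` and `α_j = x_jᴴ Q_(j) x_j / n`.
Sherman–Morrison gives `Q x_j = Q_(j) x_j / (1 + α_j)` (`res_mulVec_col`). Given the other columns,
`α_j` is a quadratic form in independent entries bounded by `L = n^a`; `variance_quadForm_le`
together with the variance of the trace puts it within `O(L/√n)` in `L²` of `a_j = E tr(Γ_j Q) / n`.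
Inserting this in the resolvent identity `trace_res_sub_trace_outerOf_inv` compares `Q` with `(-z +
(1/n) ∑ j, Γ_j / (1 + a_j))⁻¹`, with an error `O(L√n)` in the trace, hence `O(n^(a - 1/2))` after
division by `p`. That matrix is exactly `Q̄`, since `a_j = c_n ∑ s, E h_s · B s j j`.

All inverses are controlled by signs: `tr(Γ_j Q)` and `z tr(Γ_j Q)` have nonnegative imaginary part,
which keeps `1 + a_j` away from zero and puts its inverse in the closed lower half-plane. -/

/-- Bounded measurable functions. -/
structure BddMeas {α E : Type*} [MeasurableSpace α] [NormedAddCommGroup E] [MeasurableSpace E]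
    (f : α → E) : Prop where
  measurable : Measurable f
  bdd : ∃ C : ℝ, ∀ x, ‖f x‖ ≤ C

/-! ### Bounded measurable functions: closure properties that make integrability automatic. -/

namespace BddMeas

section general

variable {α β : Type*} [MeasurableSpace α] [MeasurableSpace β]
  {E : Type*} [NormedAddCommGroup E] [MeasurableSpace E] [BorelSpace E]
  [SecondCountableTopology E] {f g : α → E}

theorem integrable (hf : BddMeas f) (μ : Measure α) [IsFiniteMeasure μ] : Integrable f μ := by
  obtain ⟨C, hC⟩ := hf.bdd
  exact Integrable.of_bound hf.measurable.aestronglyMeasurable C (Eventually.of_forall hC)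

theorem const (c : E) : BddMeas (fun _ : α => c) := ⟨measurable_const, ‖c‖, fun _ => le_rfl⟩

theorem add (hf : BddMeas f) (hg : BddMeas g) : BddMeas (fun x => f x + g x) := by
  obtain ⟨C, hC⟩ := hf.bdd
  obtain ⟨D, hD⟩ := hg.bdd
  exact ⟨hf.measurable.add hg.measurable, C + D,
    fun x => (norm_add_le _ _).trans (add_le_add (hC x) (hD x))⟩

theorem sub (hf : BddMeas f) (hg : BddMeas g) : BddMeas (fun x => f x - g x) := by
  obtain ⟨C, hC⟩ := hf.bdd
  obtain ⟨D, hD⟩ := hg.bdd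
  exact ⟨hf.measurable.sub hg.measurable, C + D,
    fun x => (norm_sub_le _ _).trans (add_le_add (hC x) (hD x))⟩

theorem sum {κ : Type*} {s : Finset κ} {F : κ → α → E} (hF : ∀ k ∈ s, BddMeas (F k)) :
    BddMeas (fun x => ∑ k ∈ s, F k x) := by
  classical
  induction s using Finset.induction_on with
  | empty => simpa using const (α := α) (0 : E)
  | insert a s ha ih =>
    simp only [Finset.sum_insert ha]
    exact (hF a (Finset.mem_insert_self _ _)).add
      (ih fun k hk => hF k (Finset.mem_insert_of_mem hk))

theorem comp (hf : BddMeas f) {φ : β → α} (hφ : Measurable φ) : BddMeas (fun x => f (φ x)) := by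
  obtain ⟨C, hC⟩ := hf.bdd
  exact ⟨hf.measurable.comp hφ, C, fun x => hC _⟩

theorem norm (hf : BddMeas f) : BddMeas (fun x => ‖f x‖) := by
  obtain ⟨C, hC⟩ := hf.bdd
  exact ⟨hf.measurable.norm, C, fun x => by simpa using hC x⟩

theorem integral_prod [NormedSpace ℝ E] {f : α × β → E} (hf : BddMeas f) (ν : Measure β)
    [IsProbabilityMeasure ν] : BddMeas (fun x => ∫ y, f (x, y) ∂ν) := by
  obtain ⟨C, hC⟩ := hf.bdd
  refine ⟨hf.measurable.stronglyMeasurable.integral_prod_right'.measurable, C, fun x => ?_⟩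
  simpa using norm_integral_le_of_norm_le_const (μ := ν) (Eventually.of_forall fun y => hC (x, y))

end general

variable {α : Type*} [MeasurableSpace α]

theorem mul {𝕜 : Type*} [RCLike 𝕜] {f g : α → 𝕜} (hf : BddMeas f) (hg : BddMeas g) :
    BddMeas (fun x => f x * g x) := by
  obtain ⟨C, hC⟩ := hf.bdd
  obtain ⟨D, hD⟩ := hg.bdd
  refine ⟨hf.measurable.mul hg.measurable, C * D, fun x => ?_⟩
  rw [norm_mul]
  exact mul_le_mul (hC x) (hD x) (norm_nonneg _) ((norm_nonneg _).trans (hC x))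

theorem pow {𝕜 : Type*} [RCLike 𝕜] {f : α → 𝕜} (hf : BddMeas f) (k : ℕ) :
    BddMeas (fun x => f x ^ k) := by
  induction k with
  | zero => simpa using const (α := α) (1 : 𝕜)
  | succ k ih => simpa only [pow_succ] using ih.mul hf

theorem star {f : α → ℂ} (hf : BddMeas f) : BddMeas (fun x => star (f x)) := by
  obtain ⟨C, hC⟩ := hf.bdd
  exact ⟨continuous_star.measurable.comp hf.measurable, C, fun x => by simpa using hC x⟩

theorem re {f : α → ℂ} (hf : BddMeas f) : BddMeas (fun x => (f x).re) := by
  obtain ⟨C, hC⟩ := hf.bdd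
  exact ⟨Complex.measurable_re.comp hf.measurable, C,
    fun x => (Complex.abs_re_le_norm _).trans (hC x)⟩

theorem im {f : α → ℂ} (hf : BddMeas f) : BddMeas (fun x => (f x).im) := by
  obtain ⟨C, hC⟩ := hf.bdd
  exact ⟨Complex.measurable_im.comp hf.measurable, C,
    fun x => (Complex.abs_im_le_norm _).trans (hC x)⟩

end BddMeas

/-! ### The Efron–Stein inequality on a product probability space. -/

section EfronStein

variable {ι E : Type*} [Fintype ι] [DecidableEq ι] [MeasurableSpace E]
  (ρ : Measure E) [IsProbabilityMeasure ρ]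

/-- Resampling one coordinate preserves a product probability measure. -/
theorem measurePreserving_update (i : ι) :
    MeasurePreserving (fun q : (ι → E) × E => Function.update q.1 i q.2)
      ((Measure.pi fun _ : ι => ρ).prod ρ) (Measure.pi fun _ : ι => ρ) := by
  have hm : Measurable (fun q : (ι → E) × E => Function.update q.1 i q.2) := by
    refine measurable_pi_lambda _ fun k => ?_
    by_cases h : k = i
    · subst h; simpa using measurable_snd
    · simp only [Function.update_of_ne h]; fun_prop
  refine ⟨hm, (Measure.pi_eq fun s hs => ?_).symm⟩
  rw [Measure.map_apply hm (MeasurableSet.univ_pi hs)]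
  have : (fun q : (ι → E) × E => Function.update q.1 i q.2) ⁻¹' Set.univ.pi s =
      (Set.univ.pi (Function.update s i Set.univ)) ×ˢ s i := by
    ext ⟨x, y⟩
    simp only [Set.mem_preimage, Set.mem_pi, Set.mem_univ, true_imp_iff, Set.mem_prod]
    constructor
    · intro h
      refine ⟨fun k => ?_, by simpa using h i⟩
      by_cases hk : k = i
      · subst hk; simp
      · simpa [Function.update_of_ne hk] using h k
    · rintro ⟨h, hy⟩ k
      by_cases hk : k = i
      · subst hk; simpa using hy
      · simpa [Function.update_of_ne hk] using h k
  rw [this, Measure.prod_prod, Measure.pi_pi, ← Finset.mul_prod_erase _ _ (Finset.mem_univ i),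
    ← Finset.mul_prod_erase _ (fun k => ρ (s k)) (Finset.mem_univ i)]
  rw [Function.update_self, measure_univ, one_mul, mul_comm]
  congr 1
  refine Finset.prod_congr rfl fun k hk => ?_
  rw [Function.update_of_ne (Finset.ne_of_mem_erase hk)]

/-- Averaging over the coordinate `i`. -/
def avg {V : Type*} [NormedAddCommGroup V] [NormedSpace ℝ V] (i : ι) (f : (ι → E) → V)
    (x : ι → E) : V :=
  ∫ y, f (Function.update x i y) ∂ρ

variable {ρ}

section avg

variable {V : Type*} [NormedAddCommGroup V] [NormedSpace ℝ V] [MeasurableSpace V] [BorelSpace V]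
  [SecondCountableTopology V] {f : (ι → E) → V}

theorem BddMeas.avg (hf : BddMeas f) (i : ι) : BddMeas (avg ρ i f) :=
  (hf.comp (measurePreserving_update ρ i).measurable).integral_prod ρ

theorem integral_avg [CompleteSpace V] (hf : BddMeas f) (i : ι) :
    ∫ x, avg ρ i f x ∂(Measure.pi fun _ : ι => ρ) = ∫ x, f x ∂(Measure.pi fun _ : ι => ρ) := by
  have h := measurePreserving_update ρ i
  have h1 := (hf.comp h.measurable).integrable ((Measure.pi fun _ : ι => ρ).prod ρ)
  have h2 := integral_prod _ h1
  rw [← h.map_eq, integral_map h.measurable.aemeasurable hf.measurable.aestronglyMeasurable, h2,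
    h.map_eq]
  rfl

theorem avg_update_self (i : ι) (x : ι → E) (y : E) :
    avg ρ i f (Function.update x i y) = avg ρ i f x := by
  simp [SumSeparable.avg]

theorem avg_update_of_ne {i j : ι} (hij : i ≠ j) (h : ∀ x y, f (Function.update x j y) = f x)
    (x : ι → E) (y : E) :
    avg ρ i f (Function.update x j y) = avg ρ i f x := by
  simp only [SumSeparable.avg]
  refine integral_congr_ae (Eventually.of_forall fun w => ?_)
  dsimp only
  rw [Function.update_comm hij.symm, h]

end avg

variable {f g : (ι → E) → ℝ}

/-- A factor blind to coordinate `i` comes out of the inner average. This is the orthogonality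
behind the Pythagoras identity. -/
theorem integral_avg_mul_indep (hf : BddMeas f) (hg : BddMeas g) {i : ι}
    (h : ∀ x y, g (Function.update x i y) = g x) :
    ∫ x, avg ρ i f x * g x ∂(Measure.pi fun _ : ι => ρ)
      = ∫ x, f x * g x ∂(Measure.pi fun _ : ι => ρ) := by
  rw [← integral_avg (hf.mul hg) i]
  refine integral_congr_ae (Eventually.of_forall fun x => ?_)
  simp only [avg, h]
  rw [integral_mul_const]

/-- Pythagoras: `avg ρ i f` is the orthogonal projection of `f`. -/
theorem integral_sq_sub_avg (hf : BddMeas f) (hg : BddMeas g) {i : ι}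
    (h : ∀ x y, g (Function.update x i y) = g x) :
    ∫ x, (f x - g x) ^ 2 ∂(Measure.pi fun _ : ι => ρ) =
      ∫ x, (f x - avg ρ i f x) ^ 2 ∂(Measure.pi fun _ : ι => ρ) +
        ∫ x, (avg ρ i f x - g x) ^ 2 ∂(Measure.pi fun _ : ι => ρ) := by
  have ha := hf.avg (ρ := ρ) i
  have hd := ha.sub hg
  have hd' : ∀ x y, avg ρ i f (Function.update x i y) - g (Function.update x i y)
      = avg ρ i f x - g x := fun x y => by rw [avg_update_self, h]
  have e := integral_avg_mul_indep (ρ := ρ) hf hd hd'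
  have i1 := (hf.sub ha).pow 2
  have i2 := hd.pow 2
  have i3 := hf.mul hd
  have i4 := ha.mul hd
  have : ∀ x, (f x - g x) ^ 2 = ((f x - avg ρ i f x) ^ 2 + (avg ρ i f x - g x) ^ 2) +
      2 * (f x * (avg ρ i f x - g x) - avg ρ i f x * (avg ρ i f x - g x)) := fun x => by ring
  simp only [this]
  rw [integral_add ((i1.add i2).integrable _) (((i3.sub i4).integrable _).const_mul 2),
    integral_add (i1.integrable _) (i2.integrable _), integral_const_mul,
    integral_sub (i3.integrable _) (i4.integrable _), e]
  ring

/-- A projection is the best approximation, so the averages in Efron–Stein may be replaced by any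
convenient approximant blind to coordinate `i`. -/
theorem integral_sq_sub_avg_le (hf : BddMeas f) (hg : BddMeas g) {i : ι}
    (h : ∀ x y, g (Function.update x i y) = g x) :
    ∫ x, (f x - avg ρ i f x) ^ 2 ∂(Measure.pi fun _ : ι => ρ) ≤
      ∫ x, (f x - g x) ^ 2 ∂(Measure.pi fun _ : ι => ρ) := by
  rw [integral_sq_sub_avg hf hg h]
  exact le_add_of_nonneg_right (integral_nonneg fun x => sq_nonneg _)

theorem integral_avg_sq_le (hf : BddMeas f) (i : ι) :
    ∫ x, (avg ρ i f x) ^ 2 ∂(Measure.pi fun _ : ι => ρ) ≤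
      ∫ x, (f x) ^ 2 ∂(Measure.pi fun _ : ι => ρ) := by
  have := integral_sq_sub_avg (ρ := ρ) (i := i) hf (BddMeas.const (0 : ℝ)) (fun _ _ => rfl)
  simp only [sub_zero] at this
  rw [this]
  exact le_add_of_nonneg_left (integral_nonneg fun x => sq_nonneg _)

/-- The coordinates of `s` are averaged one after another. When `a` is added, the error splits
orthogonally into `f - avg a f` and `avg a (f - g)`, and the second part is no larger than the
previous error because `avg` contracts `L²`. -/
theorem exists_partial_average (hf : BddMeas f) (s : Finset ι) :
    ∃ g : (ι → E) → ℝ, BddMeas g ∧ (∀ i ∈ s, ∀ x y, g (Function.update x i y) = g x) ∧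
      ∫ x, g x ∂(Measure.pi fun _ : ι => ρ) = ∫ x, f x ∂(Measure.pi fun _ : ι => ρ) ∧
      ∫ x, (f x - g x) ^ 2 ∂(Measure.pi fun _ : ι => ρ) ≤
        ∑ i ∈ s, ∫ x, (f x - avg ρ i f x) ^ 2 ∂(Measure.pi fun _ : ι => ρ) := by
  induction s using Finset.induction_on with
  | empty => exact ⟨f, hf, by simp, rfl, by simp⟩
  | insert a s ha ih =>
    obtain ⟨g, hg, hgi, hgint, hle⟩ := ih
    refine ⟨avg ρ a g, hg.avg a, fun i hi => ?_, by rw [integral_avg hg, hgint], ?_⟩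
    · by_cases hia : i = a
      · subst hia; exact avg_update_self i
      · exact avg_update_of_ne (Ne.symm hia)
          (hgi i ((Finset.mem_insert.1 hi).resolve_left hia))
    · rw [Finset.sum_insert ha, integral_sq_sub_avg hf (hg.avg a) (avg_update_self a)]
      refine add_le_add le_rfl (le_trans ?_ hle)
      have := integral_avg_sq_le (ρ := ρ) (hf.sub hg) a
      refine le_trans (le_of_eq ?_) this
      refine integral_congr_ae (Eventually.of_forall fun x => ?_)
      simp only [avg]
      rw [integral_sub]
      · exact (hf.comp (measurable_update x)).integrable ρ
      · exact (hg.comp (measurable_update x)).integrable ρ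

theorem eq_of_forall_update_eq {V : Type*} {g : (ι → E) → V}
    (h : ∀ i x y, g (Function.update x i y) = g x) (x w : ι → E) : g x = g w := by
  have : ∀ s : Finset ι, g (s.piecewise x w) = g w := by
    intro s
    induction s using Finset.induction_on with
    | empty => simp
    | insert a s ha ih => rw [Finset.piecewise_insert, h, ih]
  simpa using this Finset.univ

/-- The Efron–Stein inequality. -/
theorem efronStein_real (hf : BddMeas f) {h : ι → (ι → E) → ℝ} (hh : ∀ i, BddMeas (h i))
    (hi : ∀ i x y, h i (Function.update x i y) = h i x) :
    ∫ x, (f x - ∫ w, f w ∂(Measure.pi fun _ : ι => ρ)) ^ 2 ∂(Measure.pi fun _ : ι => ρ) ≤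
      ∑ i, ∫ x, (f x - h i x) ^ 2 ∂(Measure.pi fun _ : ι => ρ) := by
  obtain ⟨g, hg, hgi, hgint, hle⟩ := exists_partial_average (ρ := ρ) hf Finset.univ
  -- Averaged over every coordinate, `g` is constant, hence equal to the mean of `f`.
  have hc : ∀ x, g x = ∫ w, f w ∂(Measure.pi fun _ : ι => ρ) := fun x => by
    rw [← hgint, integral_congr_ae (Eventually.of_forall fun w =>
      eq_of_forall_update_eq (fun i => hgi i (Finset.mem_univ _)) w x)]
    simp
  simp only [hc] at hle
  exact hle.trans (Finset.sum_le_sum fun i _ => integral_sq_sub_avg_le hf (hh i) (hi i))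

/-- The Efron–Stein inequality for complex-valued functions. -/
theorem efronStein {f : (ι → E) → ℂ} (hf : BddMeas f) {h : ι → (ι → E) → ℂ}
    (hh : ∀ i, BddMeas (h i)) (hi : ∀ i x y, h i (Function.update x i y) = h i x) :
    ∫ x, ‖f x - ∫ w, f w ∂(Measure.pi fun _ : ι => ρ)‖ ^ 2 ∂(Measure.pi fun _ : ι => ρ) ≤
      ∑ i, ∫ x, ‖f x - h i x‖ ^ 2 ∂(Measure.pi fun _ : ι => ρ) := by
  set P := Measure.pi fun _ : ι => ρ
  have hn : ∀ w : ℂ, ‖w‖ ^ 2 = w.re ^ 2 + w.im ^ 2 := fun w => by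
    rw [← Complex.normSq_eq_norm_sq, Complex.normSq_apply]; ring
  have key : ∀ g : (ι → E) → ℂ, BddMeas g → ∫ x, ‖f x - g x‖ ^ 2 ∂P =
      ∫ x, ((f x).re - (g x).re) ^ 2 ∂P + ∫ x, ((f x).im - (g x).im) ^ 2 ∂P := fun g hg => by
    simp only [hn, Complex.sub_re, Complex.sub_im]
    exact integral_add (((hf.re.sub hg.re).pow 2).integrable P)
      (((hf.im.sub hg.im).pow 2).integrable P)
  have hre : (∫ w, f w ∂P).re = ∫ w, (f w).re ∂P := (integral_re (hf.integrable P)).symm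
  have him : (∫ w, f w ∂P).im = ∫ w, (f w).im ∂P := (integral_im (hf.integrable P)).symm
  rw [key _ (BddMeas.const _), hre, him]
  simp only [fun i => key _ (hh i), Finset.sum_add_distrib]
  exact add_le_add
    (efronStein_real hf.re (fun i => (hh i).re) fun i x y => by rw [hi])
    (efronStein_real hf.im (fun i => (hh i).im) fun i x y => by rw [hi])

/-! ### Moments of functions with bounded differences. -/

section BoundedDifferences

variable {f : (ι → E) → ℂ} {h : ι → (ι → E) → ℂ} {κ : ℝ}

theorem variance_le_of_bounded_differences (hf : BddMeas f) (hh : ∀ i, BddMeas (h i))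
    (hi : ∀ i x y, h i (Function.update x i y) = h i x) (hκ : ∀ i x, ‖f x - h i x‖ ≤ κ) :
    ∫ x, ‖f x - ∫ w, f w ∂(Measure.pi fun _ : ι => ρ)‖ ^ 2 ∂(Measure.pi fun _ : ι => ρ) ≤
      Fintype.card ι * κ ^ 2 := by
  refine (efronStein hf hh hi).trans ?_
  have : ∀ i ∈ Finset.univ, ∫ x, ‖f x - h i x‖ ^ 2 ∂(Measure.pi fun _ : ι => ρ) ≤ κ ^ 2 :=
    fun i _ => by
      have := integral_mono (μ := Measure.pi fun _ : ι => ρ)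
        (((hf.sub (hh i)).norm.pow 2).integrable _) (integrable_const (κ ^ 2))
        (fun x => pow_le_pow_left₀ (norm_nonneg _) (hκ i x) 2)
      simpa using this
  simpa using Finset.sum_le_sum this

/-- Functions with bounded differences have a fourth central moment of order `(card ι)²`. -/
theorem fourth_moment_le_of_bounded_differences (hf : BddMeas f) (hh : ∀ i, BddMeas (h i))
    (hi : ∀ i x y, h i (Function.update x i y) = h i x) (hκ : ∀ i x, ‖f x - h i x‖ ≤ κ) :
    ∫ x, ‖f x - ∫ w, f w ∂(Measure.pi fun _ : ι => ρ)‖ ^ 4 ∂(Measure.pi fun _ : ι => ρ) ≤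
      11 * (Fintype.card ι : ℝ) ^ 2 * κ ^ 4 := by
  have hvar := variance_le_of_bounded_differences (ρ := ρ) hf hh hi hκ
  set P := Measure.pi fun _ : ι => ρ
  set m := ∫ w, f w ∂P
  set N : ℝ := (Fintype.card ι : ℝ)
  have hg : BddMeas fun x => f x - m := hf.sub (BddMeas.const m)
  have hu : BddMeas fun x => ‖f x - m‖ ^ 2 := hg.norm.pow 2
  have hui : ∀ i, BddMeas fun x => ‖h i x - m‖ ^ 2 := fun i =>
    ((hh i).sub (BddMeas.const m)).norm.pow 2
  -- Efron–Stein a second time, for the squared deviation: its increments are of order `κ` times the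
  -- deviation itself, so the first variance bound controls them.
  have es := efronStein_real (ρ := ρ) hu hui (fun i x y => by simp only [hi])
  have hpt : ∀ i x, (‖f x - m‖ ^ 2 - ‖h i x - m‖ ^ 2) ^ 2 ≤
      8 * κ ^ 2 * ‖f x - m‖ ^ 2 + 2 * κ ^ 4 := fun i x => by
    have h1 : |‖f x - m‖ - ‖h i x - m‖| ≤ κ := by
      refine (abs_norm_sub_norm_le _ _).trans ?_
      simpa using hκ i x
    obtain ⟨h2, h3⟩ := abs_le.1 h1
    have h4 := norm_nonneg (f x - m)
    have h5 := norm_nonneg (h i x - m)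
    have h6 : 0 ≤ κ := (abs_nonneg _).trans h1
    set a := ‖f x - m‖
    set b := ‖h i x - m‖
    have e1 : (a ^ 2 - b ^ 2) ^ 2 = (a - b) ^ 2 * (a + b) ^ 2 := by ring
    have e2 : (a - b) ^ 2 ≤ κ ^ 2 := sq_le_sq' h2 h3
    have e3 : (a + b) ^ 2 ≤ (2 * a + κ) ^ 2 := by
      apply pow_le_pow_left₀ <;> linarith
    have e4 : (2 * a + κ) ^ 2 ≤ 8 * a ^ 2 + 2 * κ ^ 2 := by nlinarith [sq_nonneg (2 * a - κ)]
    rw [e1]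
    calc (a - b) ^ 2 * (a + b) ^ 2 ≤ κ ^ 2 * (8 * a ^ 2 + 2 * κ ^ 2) :=
          mul_le_mul e2 (e3.trans e4) (sq_nonneg _) (sq_nonneg _)
      _ = _ := by ring
  have hterm : ∀ i ∈ Finset.univ, ∫ x, (‖f x - m‖ ^ 2 - ‖h i x - m‖ ^ 2) ^ 2 ∂P ≤
      8 * κ ^ 2 * (N * κ ^ 2) + 2 * κ ^ 4 := fun i _ => by
    refine (integral_mono (((hu.sub (hui i)).pow 2).integrable P)
      (((hu.integrable P).const_mul _).add (integrable_const _)) (hpt i)).trans ?_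
    simp only [Pi.add_apply]
    rw [integral_add ((hu.integrable P).const_mul _) (integrable_const _), integral_const_mul]
    simp only [integral_const, probReal_univ, one_smul]
    gcongr
  have hsum := es.trans (Finset.sum_le_sum hterm)
  rw [Finset.sum_const, Finset.card_univ, nsmul_eq_mul] at hsum
  set e := ∫ x, ‖f x - m‖ ^ 2 ∂P
  have he : 0 ≤ e := integral_nonneg fun x => sq_nonneg _
  have hexp : ∫ x, ‖f x - m‖ ^ 4 ∂P = ∫ x, (‖f x - m‖ ^ 2 - e) ^ 2 ∂P + e ^ 2 := by
    have : ∀ x, (‖f x - m‖ ^ 2 - e) ^ 2 =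
      ‖f x - m‖ ^ 4 - 2 * e * ‖f x - m‖ ^ 2 + e ^ 2 := fun x => by ring
    simp only [this]
    rw [integral_add (f := fun x => ‖f x - m‖ ^ 4 - 2 * e * ‖f x - m‖ ^ 2)
      (((hg.norm.pow 4).integrable P).sub ((hu.integrable P).const_mul _))
      (integrable_const _), integral_sub ((hg.norm.pow 4).integrable P)
      ((hu.integrable P).const_mul _), integral_const_mul]
    simp only [integral_const, probReal_univ, one_smul]
    change _ = _ - 2 * e * e + _ + _
    ring
  rw [hexp]
  -- Absorbs the term linear in `N` into the quadratic one; this is the 11 = 8 + 1 + 2.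
  have hN : N ≤ N ^ 2 := by
    have : Fintype.card ι ≤ Fintype.card ι ^ 2 := Nat.le_self_pow two_ne_zero _
    simp only [N]
    exact_mod_cast this
  have he2 : e ^ 2 ≤ (N * κ ^ 2) ^ 2 := pow_le_pow_left₀ he hvar 2
  have hk4 : (0 : ℝ) ≤ κ ^ 4 := by positivity
  calc _ ≤ N * (8 * κ ^ 2 * (N * κ ^ 2) + 2 * κ ^ 4) + (N * κ ^ 2) ^ 2 := add_le_add hsum he2
    _ = 9 * N ^ 2 * κ ^ 4 + 2 * (N * κ ^ 4) := by ring
    _ ≤ 9 * N ^ 2 * κ ^ 4 + 2 * (N ^ 2 * κ ^ 4) := by gcongr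
    _ = _ := by ring

end BoundedDifferences

end EfronStein

/-! ### Euclidean norms, operator norms and traces. -/

section LinearAlgebra

variable {m k : Type*} [Fintype m] [DecidableEq m] [Fintype k] [DecidableEq k]

/-- The Euclidean norm of a complex vector. -/
def l2 (u : m → ℂ) : ℝ := ‖(WithLp.toLp 2 u : EuclideanSpace ℂ m)‖

theorem l2_nonneg (u : m → ℂ) : 0 ≤ l2 u := norm_nonneg _

theorem l2_sq (u : m → ℂ) : l2 u ^ 2 = ∑ i, ‖u i‖ ^ 2 := by
  simp [l2, EuclideanSpace.norm_sq_eq]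

theorem l2_smul (c : ℂ) (u : m → ℂ) : l2 (c • u) = ‖c‖ * l2 u := by
  simp [l2, WithLp.toLp_smul, norm_smul]

theorem l2_star (u : m → ℂ) : l2 (star u) = l2 u := by
  rw [← sq_eq_sq₀ (l2_nonneg _) (l2_nonneg _), l2_sq, l2_sq]
  simp

theorem l2_eq_zero {u : m → ℂ} (h : l2 u = 0) : u = 0 := by
  have := norm_eq_zero.1 h
  funext i
  simpa using congrArg (fun x : EuclideanSpace ℂ m => x i) this

theorem l2_single_one (i : m) : l2 (Pi.single i (1 : ℂ)) = 1 := by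
  rw [← sq_eq_sq₀ (l2_nonneg _) zero_le_one, l2_sq, Finset.sum_eq_single i] <;>
    simp +contextual

theorem star_dotProduct_self (u : m → ℂ) : star u ⬝ᵥ u = ((l2 u ^ 2 : ℝ) : ℂ) := by
  rw [l2_sq]
  simp [dotProduct, Complex.conj_mul']

theorem norm_star_dotProduct_le (u w : m → ℂ) : ‖star u ⬝ᵥ w‖ ≤ l2 u * l2 w := by
  have := norm_inner_le_norm (𝕜 := ℂ) (WithLp.toLp 2 u : EuclideanSpace ℂ m) (WithLp.toLp 2 w)
  rw [EuclideanSpace.inner_eq_star_dotProduct, dotProduct_comm] at this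
  exact this

theorem norm_dotProduct_le (u w : m → ℂ) : ‖u ⬝ᵥ w‖ ≤ l2 u * l2 w := by
  simpa [l2_star] using norm_star_dotProduct_le (star u) w

theorem l2_mulVec_le (A : Matrix m k ℂ) (u : k → ℂ) : l2 (A.mulVec u) ≤ ‖A‖ * l2 u :=
  A.l2_opNorm_mulVec (WithLp.toLp 2 u)

theorem opNorm_le_of_l2 {A : Matrix m k ℂ} {C : ℝ} (hC : 0 ≤ C)
    (h : ∀ u, l2 (A.mulVec u) ≤ C * l2 u) : ‖A‖ ≤ C := by
  rw [Matrix.l2_opNorm_def]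
  refine ContinuousLinearMap.opNorm_le_bound _ hC fun x => ?_
  exact h x.ofLp

theorem sum_sq_col_le (A : Matrix m k ℂ) (j : k) : ∑ i, ‖A i j‖ ^ 2 ≤ ‖A‖ ^ 2 := by
  have h := l2_mulVec_le A (Pi.single j 1)
  rw [l2_single_one, mul_one] at h
  have := pow_le_pow_left₀ (l2_nonneg _) h 2
  rw [l2_sq] at this
  simpa [Matrix.col_apply] using this

theorem sum_sq_row_le (A : Matrix m k ℂ) (i : m) : ∑ j, ‖A i j‖ ^ 2 ≤ ‖A‖ ^ 2 := by
  have := sum_sq_col_le A.conjTranspose i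
  simpa [Matrix.l2_opNorm_conjTranspose] using this

theorem norm_entry_le (A : Matrix m k ℂ) (i : m) (j : k) : ‖A i j‖ ≤ ‖A‖ := by
  have h := (Finset.single_le_sum (f := fun i => ‖A i j‖ ^ 2) (fun _ _ => sq_nonneg _)
    (Finset.mem_univ i)).trans (sum_sq_col_le A j)
  exact (pow_le_pow_iff_left₀ (norm_nonneg _) (norm_nonneg _) two_ne_zero).1 h

theorem norm_trace_le (A : Matrix m m ℂ) : ‖A.trace‖ ≤ Fintype.card m * ‖A‖ := by
  refine (norm_sum_le _ _).trans ?_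
  simpa using Finset.sum_le_sum fun i (_ : i ∈ Finset.univ) => norm_entry_le A i i

theorem l2_mul_l2_le_norm_vecMulVec (a : m → ℂ) (b : k → ℂ) :
    l2 a * l2 b ≤ ‖Matrix.vecMulVec a b‖ := by
  rcases (l2_nonneg b).eq_or_lt with hb | hb
  · rw [← hb, mul_zero]; exact norm_nonneg _
  have h := l2_mulVec_le (Matrix.vecMulVec a b) (star b)
  have e : (Matrix.vecMulVec a b).mulVec (star b) = ((l2 b ^ 2 : ℝ) : ℂ) • a := by
    rw [Matrix.vecMulVec_mulVec, ← star_dotProduct_self, dotProduct_comm]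
    funext i
    simp [mul_comm]
  rw [e, l2_smul, l2_star, Complex.norm_real, Real.norm_of_nonneg (sq_nonneg _)] at h
  nlinarith

/-- For a rank-one matrix the trace pairing costs only operator norms, without the dimension factor
of `norm_trace_le`. -/
theorem norm_trace_vecMulVec_mul_le (a b : m → ℂ) (M : Matrix m m ℂ) :
    ‖(Matrix.vecMulVec a b * M).trace‖ ≤ ‖Matrix.vecMulVec a b‖ * ‖M‖ := by
  rw [Matrix.trace_mul_comm, Matrix.mul_vecMulVec, Matrix.trace_vecMulVec]
  calc _ ≤ l2 (M.mulVec a) * l2 b := norm_dotProduct_le _ _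
    _ ≤ (‖M‖ * l2 a) * l2 b := by gcongr; exacts [l2_nonneg _, l2_mulVec_le _ _]
    _ = l2 a * l2 b * ‖M‖ := by ring
    _ ≤ _ := by gcongr; exact l2_mul_l2_le_norm_vecMulVec a b

/-- A matrix whose quadratic form has imaginary part at most `-v‖u‖²` is invertible, with inverse
of norm at most `1 / v`. -/
theorem isUnit_of_im_form {H : Matrix m m ℂ} {v : ℝ} (hv : 0 < v)
    (hH : ∀ u : m → ℂ, (star u ⬝ᵥ H.mulVec u).im ≤ -v * l2 u ^ 2) :
    IsUnit H ∧ ‖H⁻¹‖ ≤ 1 / v := by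
  -- Cauchy–Schwarz turns the bound on the form into coercivity, which gives injectivity and the
  -- norm of the inverse at once.
  have low : ∀ u, v * l2 u ≤ l2 (H.mulVec u) := fun u => by
    have h1 := (neg_le_abs _).trans (Complex.abs_im_le_norm (star u ⬝ᵥ H.mulVec u))
    have h2 := norm_star_dotProduct_le u (H.mulVec u)
    have h3 := hH u
    have h4 : l2 u * (v * l2 u) ≤ l2 u * l2 (H.mulVec u) := by nlinarith
    rcases (l2_nonneg u).eq_or_lt with h | h
    · rw [← h, mul_zero]; exact l2_nonneg _
    · exact le_of_mul_le_mul_left h4 h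
  have hu : IsUnit H := by
    rw [← Matrix.mulVec_injective_iff_isUnit]
    intro x y hxy
    have h := low (x - y)
    rw [Matrix.mulVec_sub, sub_eq_zero.2 hxy] at h
    have h0 : l2 (0 : m → ℂ) = 0 := by simp [l2]
    rw [h0] at h
    have : l2 (x - y) = 0 := le_antisymm (by nlinarith) (l2_nonneg _)
    exact sub_eq_zero.1 (l2_eq_zero this)
  refine ⟨hu, opNorm_le_of_l2 (by positivity) fun u => ?_⟩
  have h := low (H⁻¹.mulVec u)
  rw [Matrix.mulVec_mulVec, Matrix.mul_nonsing_inv _ ((Matrix.isUnit_iff_isUnit_det _).1 hu),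
    Matrix.one_mulVec] at h
  rw [div_mul_eq_mul_div, one_mul, le_div_iff₀ hv, mul_comm]
  exact h

/-! ### Resolvents of positive semidefinite matrices and rank-one perturbations. -/

section Resolvent

variable {S : Matrix m m ℂ} {z : ℂ}

theorem form_sub_smul_one (S : Matrix m m ℂ) (z : ℂ) (u : m → ℂ) :
    star u ⬝ᵥ (S - z • (1 : Matrix m m ℂ)).mulVec u =
      star u ⬝ᵥ S.mulVec u - z * ((l2 u ^ 2 : ℝ) : ℂ) := by
  rw [Matrix.sub_mulVec, Matrix.smul_mulVec, Matrix.one_mulVec, dotProduct_sub, dotProduct_smul,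
    star_dotProduct_self, smul_eq_mul]

theorem isUnit_sub_smul_one (hS : S.PosSemidef) (hz : 0 < z.im) :
    IsUnit (S - z • (1 : Matrix m m ℂ)) ∧ ‖(S - z • (1 : Matrix m m ℂ))⁻¹‖ ≤ 1 / z.im := by
  refine isUnit_of_im_form hz fun u => ?_
  have h := (Complex.le_def.1 (hS.dotProduct_mulVec_nonneg u)).2
  rw [form_sub_smul_one, Complex.sub_im, ← h, Complex.im_mul_ofReal]
  simp

theorem isUnit_det_sub_smul_one (hS : S.PosSemidef) (hz : 0 < z.im) :
    IsUnit (S - z • (1 : Matrix m m ℂ)).det :=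
  (Matrix.isUnit_iff_isUnit_det _).1 (isUnit_sub_smul_one hS hz).1

/-- With `w = Qu`, the form is the conjugate of `wᴴSw - z‖w‖²`. Its imaginary part is `Im z · ‖w‖²`;
after multiplication by `z` it is `Im z · wᴴSw`. -/
theorem form_resolvent_im_nonneg (hS : S.PosSemidef) (hz : 0 < z.im) (u : m → ℂ) :
    0 ≤ (star u ⬝ᵥ (S - z • (1 : Matrix m m ℂ))⁻¹.mulVec u).im ∧
      0 ≤ (z * (star u ⬝ᵥ (S - z • (1 : Matrix m m ℂ))⁻¹.mulVec u)).im := by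
  set w := (S - z • (1 : Matrix m m ℂ))⁻¹.mulVec u with hw
  have hu : (S - z • (1 : Matrix m m ℂ)).mulVec w = u := by
    rw [hw, Matrix.mulVec_mulVec, Matrix.mul_nonsing_inv _ (isUnit_det_sub_smul_one hS hz),
      Matrix.one_mulVec]
  have e : star u ⬝ᵥ w = star (star w ⬝ᵥ S.mulVec w - z * ((l2 w ^ 2 : ℝ) : ℂ)) := by
    rw [← form_sub_smul_one, hu, Matrix.star_dotProduct]
  have h := Complex.le_def.1 (hS.dotProduct_mulVec_nonneg w)
  have h1 : 0 ≤ (star w ⬝ᵥ S.mulVec w).re := h.1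
  have h2 : (star w ⬝ᵥ S.mulVec w).im = 0 := h.2.symm
  rw [e]
  generalize (star w ⬝ᵥ S.mulVec w) = q at h1 h2
  have h3 := sq_nonneg (l2 w)
  constructor
  · simp only [Complex.star_def, Complex.conj_im, Complex.sub_im, h2, Complex.im_mul_ofReal]
    nlinarith
  · simp only [Complex.star_def, Complex.mul_im, Complex.conj_im, Complex.conj_re, Complex.sub_im,
      Complex.sub_re, h2, Complex.re_mul_ofReal, Complex.ofReal_re, Complex.ofReal_im]
    nlinarith [mul_nonneg hz.le h1]

theorem trace_gram_mul_resolvent_im_nonneg (hS : S.PosSemidef) (hz : 0 < z.im)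
    (G : Matrix m k ℂ) :
    0 ≤ ((G * G.conjTranspose) * (S - z • (1 : Matrix m m ℂ))⁻¹).trace.im ∧
      0 ≤ (z * ((G * G.conjTranspose) * (S - z • (1 : Matrix m m ℂ))⁻¹).trace).im := by
  have e : ((G * G.conjTranspose) * (S - z • (1 : Matrix m m ℂ))⁻¹).trace =
      ∑ i, star (G.col i) ⬝ᵥ (S - z • (1 : Matrix m m ℂ))⁻¹.mulVec (G.col i) := by
    rw [Matrix.mul_assoc, Matrix.trace_mul_comm, Matrix.mul_assoc]
    simp only [Matrix.trace, Matrix.diag, Matrix.mul_apply, dotProduct, Matrix.mulVec,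
      Matrix.conjTranspose_apply, Matrix.col_apply, Pi.star_apply]
  rw [e, Finset.mul_sum]
  simp only [Complex.im_sum]
  exact ⟨Finset.sum_nonneg fun i _ => (form_resolvent_im_nonneg hS hz _).1,
    Finset.sum_nonneg fun i _ => (form_resolvent_im_nonneg hS hz _).2⟩

/-- `‖z‖ ‖1 + α‖ ≥ Im (z + zα) ≥ Im z`. This bounds every Sherman–Morrison denominator from below.
-/
theorem norm_one_add_ge (hz : 0 < z.im) {α : ℂ} (h : 0 ≤ (z * α).im) :
    z.im / ‖z‖ ≤ ‖1 + α‖ := by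
  have hz0 : 0 < ‖z‖ := norm_pos_iff.2 fun h => by simp [h] at hz
  rw [div_le_iff₀ hz0, mul_comm, ← norm_mul]
  refine le_trans ?_ ((le_abs_self _).trans (Complex.abs_im_le_norm _))
  rw [mul_add, mul_one, Complex.add_im]
  linarith

theorem one_add_ne_zero (hz : 0 < z.im) {α : ℂ} (h : 0 ≤ (z * α).im) : 1 + α ≠ 0 := by
  have hz0 : 0 < ‖z‖ := norm_pos_iff.2 fun h => by simp [h] at hz
  have := norm_one_add_ge hz h
  exact norm_pos_iff.1 (lt_of_lt_of_le (by positivity) this)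

theorem norm_inv_one_add_le (hz : 0 < z.im) {α : ℂ} (h : 0 ≤ (z * α).im) :
    ‖(1 + α)⁻¹‖ ≤ ‖z‖ / z.im := by
  have hz0 : 0 < ‖z‖ := norm_pos_iff.2 fun h => by simp [h] at hz
  rw [norm_inv, ← inv_div]
  exact inv_anti₀ (by positivity) (norm_one_add_ge hz h)

theorem inv_one_add_im_nonpos {α : ℂ} (h : 0 ≤ α.im) : ((1 + α)⁻¹).im ≤ 0 := by
  rw [Complex.inv_im]
  exact div_nonpos_of_nonpos_of_nonneg (by simpa using h) (Complex.normSq_nonneg _)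

section RankOne

variable {S' : Matrix m m ℂ} {w : m → ℂ} {c : ℂ}

theorem resolvent_rankOne (hS : S.PosSemidef) (hS' : S'.PosSemidef) (hz : 0 < z.im)
    (h : S' = S + c • Matrix.vecMulVec w (star w)) :
    (S' - z • (1 : Matrix m m ℂ))⁻¹ - (S - z • (1 : Matrix m m ℂ))⁻¹ =
      Matrix.vecMulVec (-(c • (S' - z • (1 : Matrix m m ℂ))⁻¹.mulVec w))
        (Matrix.vecMul (star w) (S - z • (1 : Matrix m m ℂ))⁻¹) := by
  set Q' := (S' - z • (1 : Matrix m m ℂ))⁻¹ with hQ'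
  set Q := (S - z • (1 : Matrix m m ℂ))⁻¹ with hQ
  have h1 : Q' * (S' - z • (1 : Matrix m m ℂ)) = 1 :=
    Matrix.nonsing_inv_mul _ (isUnit_det_sub_smul_one hS' hz)
  have h2 : (S - z • (1 : Matrix m m ℂ)) * Q = 1 :=
    Matrix.mul_nonsing_inv _ (isUnit_det_sub_smul_one hS hz)
  have e : Q' - Q = Q' * ((S - z • (1 : Matrix m m ℂ)) - (S' - z • (1 : Matrix m m ℂ))) * Q := by
    rw [Matrix.mul_sub, Matrix.sub_mul, h1, Matrix.mul_assoc, h2, Matrix.mul_one, Matrix.one_mul]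
  have e2 : (S - z • (1 : Matrix m m ℂ)) - (S' - z • (1 : Matrix m m ℂ)) =
      (-c) • Matrix.vecMulVec w (star w) := by rw [h, neg_smul]; abel
  rw [e, e2, Matrix.mul_smul, Matrix.smul_mul, Matrix.mul_vecMulVec, Matrix.vecMulVec_mul,
    ← Matrix.smul_vecMulVec, neg_smul]

/-- The difference of the resolvents has rank one, and the triangle inequality bounds its norm by `2
/ Im z` however large `w` is. -/
theorem norm_trace_resolvent_rankOne_le (hS : S.PosSemidef) (hS' : S'.PosSemidef) (hz : 0 < z.im)
    (h : S' = S + c • Matrix.vecMulVec w (star w)) (M : Matrix m m ℂ) :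
    ‖((S' - z • (1 : Matrix m m ℂ))⁻¹ * M).trace - ((S - z • (1 : Matrix m m ℂ))⁻¹ * M).trace‖ ≤
      2 / z.im * ‖M‖ := by
  rw [← Matrix.trace_sub, ← Matrix.sub_mul, resolvent_rankOne hS hS' hz h]
  refine (norm_trace_vecMulVec_mul_le _ _ _).trans ?_
  gcongr
  rw [← resolvent_rankOne hS hS' hz h]
  refine (norm_sub_le _ _).trans ?_
  have := add_le_add (isUnit_sub_smul_one hS' hz).2 (isUnit_sub_smul_one hS hz).2
  refine this.trans (le_of_eq (by ring))

/-- Sherman–Morrison applied to `w`, in a form free of division. -/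
theorem resolvent_rankOne_mulVec (hS : S.PosSemidef) (hS' : S'.PosSemidef) (hz : 0 < z.im)
    (h : S' = S + c • Matrix.vecMulVec w (star w)) :
    (1 + c * (star w ⬝ᵥ (S - z • (1 : Matrix m m ℂ))⁻¹.mulVec w)) •
      (S' - z • (1 : Matrix m m ℂ))⁻¹.mulVec w = (S - z • (1 : Matrix m m ℂ))⁻¹.mulVec w := by
  have e := congrArg (fun H => H.mulVec w) (resolvent_rankOne hS hS' hz h)
  simp only [Matrix.sub_mulVec, Matrix.vecMulVec_mulVec, ← Matrix.dotProduct_mulVec] at e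
  rw [sub_eq_iff_eq_add] at e
  funext i
  have ei := congrFun e i
  simp only [Pi.add_apply, Pi.smul_apply, Pi.neg_apply, smul_eq_mul, MulOpposite.smul_eq_mul_unop,
    MulOpposite.unop_op] at ei ⊢
  linear_combination ei

end RankOne

end Resolvent

/-! ### Sample covariance matrices as sums over columns. -/

section Columns

variable {n : ℕ} {z : ℂ}

/-- The sample covariance matrix of a family of columns. -/
def gram (W : Fin n → m → ℂ) : Matrix m m ℂ :=
  (1 / (n : ℂ)) • ∑ j, Matrix.vecMulVec (W j) (star (W j))

/-- The resolvent of the sample covariance matrix of a family of columns. -/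
def res (W : Fin n → m → ℂ) (z : ℂ) : Matrix m m ℂ := (gram W - z • (1 : Matrix m m ℂ))⁻¹

theorem gram_posSemidef (W : Fin n → m → ℂ) : (gram W).PosSemidef := by
  refine Matrix.PosSemidef.smul (Matrix.posSemidef_sum _ fun j _ =>
    Matrix.posSemidef_vecMulVec_self_star _) ?_
  rw [one_div, ← Complex.ofReal_natCast, ← Complex.ofReal_inv]
  exact Complex.zero_le_real.2 (by positivity)

theorem gram_eq_add (W : Fin n → m → ℂ) (j : Fin n) :
    gram W = gram (Function.update W j 0) +
      (1 / (n : ℂ)) • Matrix.vecMulVec (W j) (star (W j)) := by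
  rw [gram, gram, ← smul_add]
  congr 1
  rw [← Finset.add_sum_erase _ _ (Finset.mem_univ j),
    ← Finset.add_sum_erase _ (fun i => Matrix.vecMulVec (Function.update W j 0 i) _)
      (Finset.mem_univ j), add_comm]
  simp only [Function.update_self, star_zero, Matrix.vecMulVec_zero, zero_add]
  congr 1
  refine Finset.sum_congr rfl fun i hi => ?_
  rw [Function.update_of_ne (Finset.ne_of_mem_erase hi)]

theorem norm_res_le (hz : 0 < z.im) (W : Fin n → m → ℂ) : ‖res W z‖ ≤ 1 / z.im :=
  (isUnit_sub_smul_one (gram_posSemidef W) hz).2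

theorem norm_trace_res_sub_le (hz : 0 < z.im) (W : Fin n → m → ℂ) (j : Fin n)
    (M : Matrix m m ℂ) :
    ‖(res W z * M).trace - (res (Function.update W j 0) z * M).trace‖ ≤ 2 / z.im * ‖M‖ :=
  norm_trace_resolvent_rankOne_le (gram_posSemidef _) (gram_posSemidef _) hz (gram_eq_add W j) M

theorem norm_trace_res_mul_le (hz : 0 < z.im) (W : Fin n → m → ℂ) (M : Matrix m m ℂ) :
    ‖(res W z * M).trace‖ ≤ Fintype.card m * (1 / z.im * ‖M‖) := by
  refine (norm_trace_le _).trans ?_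
  gcongr
  refine (norm_mul_le _ _).trans ?_
  gcongr
  exact norm_res_le hz W

theorem res_mulVec_col (hz : 0 < z.im) (W : Fin n → m → ℂ) (j : Fin n) :
    (res W z).mulVec (W j) = (1 + 1 / (n : ℂ) *
      (star (W j) ⬝ᵥ (res (Function.update W j 0) z).mulVec (W j)))⁻¹ •
      (res (Function.update W j 0) z).mulVec (W j) := by
  have h := resolvent_rankOne_mulVec (gram_posSemidef _) (gram_posSemidef _) hz (gram_eq_add W j)
  have hne : (1 + 1 / (n : ℂ) *
      (star (W j) ⬝ᵥ (res (Function.update W j 0) z).mulVec (W j))) ≠ 0 := by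
    refine one_add_ne_zero hz ?_
    have := (form_resolvent_im_nonneg (gram_posSemidef (Function.update W j 0)) hz (W j)).2
    rw [mul_left_comm, one_div, ← Complex.ofReal_natCast, ← Complex.ofReal_inv,
      Complex.im_ofReal_mul]
    exact mul_nonneg (by positivity) this
  rw [eq_inv_smul_iff₀ hne]
  exact h

/-- The source of measurability for all resolvent statistics; inversion is continuous at units. -/
theorem continuous_res (hz : 0 < z.im) : Continuous fun W : Fin n → m → ℂ => res W z := by
  have hg : Continuous fun W : Fin n → m → ℂ => gram W - z • (1 : Matrix m m ℂ) := by
    unfold gram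
    have hs : Continuous fun W : Fin n → m → ℂ =>
        ∑ j, Matrix.vecMulVec (W j) (star (W j)) := by
      refine continuous_finsetSum _ fun j _ => ?_
      refine continuous_matrix fun a b => ?_
      simp only [Matrix.vecMulVec_apply, Pi.star_apply]
      fun_prop
    fun_prop
  rw [continuous_iff_continuousAt]
  intro W
  have hu := (isUnit_sub_smul_one (gram_posSemidef W) hz).1
  obtain ⟨u, hu⟩ := hu
  unfold res
  simp only [Matrix.nonsing_inv_eq_ringInverse]
  have h1 := NormedRing.inverse_continuousAt u
  rw [hu] at h1
  exact ContinuousAt.comp (f := fun W : Fin n → m → ℂ => gram W - z • (1 : Matrix m m ℂ)) h1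
    hg.continuousAt

theorem continuous_trace_res (hz : 0 < z.im) (M : Matrix m m ℂ) :
    Continuous fun W : Fin n → m → ℂ => (res W z * M).trace :=
  ((continuous_res hz).matrix_mul continuous_const).matrix_trace

end Columns

end LinearAlgebra

/-! ### Mean and variance of quadratic forms in independent bounded entries. -/

section QuadraticForm

variable {I Ω : Type*} [Fintype I] [DecidableEq I] [MeasurableSpace Ω]

/-- Bounded entries with mean zero and unit variance. -/
structure StdEntries (μ : Measure Ω) (ξ : I → Ω → ℂ) (L : ℝ) : Prop where
  measurable : ∀ i, Measurable (ξ i)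
  bound : ∀ i ω, ‖ξ i ω‖ ≤ L
  mean : ∀ i, ∫ ω, ξ i ω ∂μ = 0
  var : ∀ i, ∫ ω, ‖ξ i ω‖ ^ 2 ∂μ = 1

/-- The random vector with independent entries distributed as `ξ i`. -/
def entryVec (ξ : I → Ω → ℂ) (y : I → Ω) : I → ℂ := fun i => ξ i (y i)

theorem BddMeas.dotProduct {α : Type*} [MeasurableSpace α] {f g : α → I → ℂ}
    (hf : ∀ i, BddMeas fun x => f x i) (hg : ∀ i, BddMeas fun x => g x i) :
    BddMeas fun x => f x ⬝ᵥ g x :=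
  BddMeas.sum fun i _ => (hf i).mul (hg i)

theorem BddMeas.mulVec {α k : Type*} [MeasurableSpace α] {f : α → I → ℂ}
    (hf : ∀ i, BddMeas fun x => f x i) (T : Matrix k I ℂ) (i : k) :
    BddMeas fun x => (T.mulVec (f x)) i :=
  BddMeas.dotProduct (f := fun _ => T i) (fun _ => BddMeas.const _) hf

variable {μ : Measure Ω} [IsProbabilityMeasure μ] {ξ : I → Ω → ℂ} {L : ℝ}

namespace StdEntries

theorem bddMeas (h : StdEntries μ ξ L) (i : I) : BddMeas (ξ i) := ⟨h.measurable i, L, h.bound i⟩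

theorem bddMeas_entryVec (h : StdEntries μ ξ L) (i : I) : BddMeas fun y => entryVec ξ y i :=
  (h.bddMeas i).comp (measurable_pi_apply i)

theorem integral_eval {V : Type*} [NormedAddCommGroup V] [NormedSpace ℝ V] [MeasurableSpace V]
    [BorelSpace V] [SecondCountableTopology V] {g : Ω → V} (hg : BddMeas g) (i : I) :
    ∫ y, g (y i) ∂(Measure.pi fun _ : I => μ) = ∫ ω, g ω ∂μ := by
  have h := measurePreserving_eval (fun _ : I => μ) i
  conv_rhs => rw [← h.map_eq]
  rw [integral_map h.measurable.aemeasurable hg.measurable.aestronglyMeasurable]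

theorem integral_star_mul (h : StdEntries μ ξ L) (i k : I) :
    ∫ y, star (entryVec ξ y i) * entryVec ξ y k ∂(Measure.pi fun _ : I => μ) =
      if i = k then 1 else 0 := by
  by_cases hik : i = k
  · subst hik
    rw [if_pos rfl]
    have := integral_eval (μ := μ) ((h.bddMeas i).star.mul (h.bddMeas i)) i
    refine this.trans ?_
    simp only [Complex.star_def, Complex.conj_mul']
    have hv := h.var i
    rw [← Complex.ofReal_one, ← hv, ← integral_complex_ofReal]
    simp
  · rw [if_neg hik, ← integral_avg ((h.bddMeas_entryVec i).star.mul (h.bddMeas_entryVec k)) k]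
    have : ∀ y, avg μ k (fun y => star (entryVec ξ y i) * entryVec ξ y k) y = 0 := fun y => by
      simp only [avg, entryVec, Function.update_self, Function.update_of_ne hik]
      rw [integral_const_mul, h.mean, mul_zero]
    simp only [this, integral_zero]

theorem bddMeas_quadForm (h : StdEntries μ ξ L) (T : Matrix I I ℂ) :
    BddMeas fun y => star (entryVec ξ y) ⬝ᵥ T.mulVec (entryVec ξ y) :=
  BddMeas.dotProduct (f := fun y => star (entryVec ξ y)) (fun i => (h.bddMeas_entryVec i).star)
    (BddMeas.mulVec h.bddMeas_entryVec T)

theorem bddMeas_linForm (h : StdEntries μ ξ L) (t : I → ℂ) :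
    BddMeas fun y => t ⬝ᵥ entryVec ξ y :=
  BddMeas.dotProduct (f := fun _ => t) (fun _ => BddMeas.const _) h.bddMeas_entryVec

theorem integral_quadForm (h : StdEntries μ ξ L) (T : Matrix I I ℂ) :
    ∫ y, star (entryVec ξ y) ⬝ᵥ T.mulVec (entryVec ξ y) ∂(Measure.pi fun _ : I => μ) =
      T.trace := by
  have e : ∀ y, star (entryVec ξ y) ⬝ᵥ T.mulVec (entryVec ξ y) =
      ∑ i, ∑ k, T i k * (star (entryVec ξ y i) * entryVec ξ y k) := fun y => by
    simp only [dotProduct, Matrix.mulVec, Finset.mul_sum, Pi.star_apply]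
    refine Finset.sum_congr rfl fun i _ => Finset.sum_congr rfl fun k _ => by ring
  have hb : ∀ i k, BddMeas fun y => T i k * (star (entryVec ξ y i) * entryVec ξ y k) :=
    fun i k => (BddMeas.const _).mul ((h.bddMeas_entryVec i).star.mul (h.bddMeas_entryVec k))
  simp only [e]
  rw [integral_finsetSum _ fun i _ => (BddMeas.sum fun k _ => hb i k).integrable _]
  refine Finset.sum_congr rfl fun i _ => ?_
  rw [integral_finsetSum _ fun k _ => (hb i k).integrable _]
  simp only [integral_const_mul, h.integral_star_mul]
  simp

/-- The squared modulus is the quadratic form of a rank-one matrix whose trace is `‖t‖²`. -/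
theorem integral_norm_linForm_sq (h : StdEntries μ ξ L) (t : I → ℂ) :
    ∫ y, ‖t ⬝ᵥ entryVec ξ y‖ ^ 2 ∂(Measure.pi fun _ : I => μ) = l2 t ^ 2 := by
  have e := h.integral_quadForm (Matrix.vecMulVec (star t) t)
  rw [Matrix.trace_vecMulVec, star_dotProduct_self] at e
  have e2 : ∀ y, star (entryVec ξ y) ⬝ᵥ (Matrix.vecMulVec (star t) t).mulVec (entryVec ξ y) =
      ((‖t ⬝ᵥ entryVec ξ y‖ ^ 2 : ℝ) : ℂ) := fun y => by
    rw [Matrix.vecMulVec_mulVec, dotProduct_smul, MulOpposite.smul_eq_mul_unop,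
      MulOpposite.unop_op, Matrix.star_dotProduct_star, Complex.ofReal_pow, ← Complex.conj_mul']
    rfl
  simp only [e2] at e
  rw [integral_complex_ofReal] at e
  exact_mod_cast e

/-- The fourth moment is at most `L²` times the second, so only the bound `L` on the entries enters.
-/
theorem integral_sq_norm_sq_sub_one_le (h : StdEntries μ ξ L) (i : I) :
    ∫ y, (‖entryVec ξ y i‖ ^ 2 - 1) ^ 2 ∂(Measure.pi fun _ : I => μ) ≤ L ^ 2 := by
  have hb := (h.bddMeas i).norm.pow 2
  have := integral_eval (μ := μ) ((hb.sub (BddMeas.const 1)).pow 2) i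
  refine (le_of_eq this).trans ?_
  have hle : ∀ ω, (‖ξ i ω‖ ^ 2 - 1) ^ 2 ≤ (L ^ 2 - 2) * ‖ξ i ω‖ ^ 2 + 1 := fun ω => by
    have h1 := pow_le_pow_left₀ (norm_nonneg _) (h.bound i ω) 2
    nlinarith [mul_nonneg (sq_nonneg ‖ξ i ω‖) (sub_nonneg.2 h1)]
  refine (integral_mono (((hb.sub (BddMeas.const 1)).pow 2).integrable μ)
    (((hb.integrable μ).const_mul _).add (integrable_const _)) hle).trans ?_
  simp only [Pi.add_apply]
  rw [integral_add ((hb.integrable μ).const_mul _) (integrable_const _), integral_const_mul, h.var]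
  simp only [integral_const, probReal_univ, one_smul]
  linarith

end StdEntries

theorem l2_update_zero_sq_le (t : I → ℂ) (i : I) : l2 (Function.update t i 0) ^ 2 ≤ l2 t ^ 2 := by
  rw [l2_sq, l2_sq]
  refine Finset.sum_le_sum fun k _ => ?_
  by_cases hk : k = i
  · subst hk; simp
  · simp [hk]

theorem dotProduct_update_zero (t ζ : I → ℂ) (i : I) :
    t ⬝ᵥ Function.update ζ i 0 = Function.update t i 0 ⬝ᵥ ζ := by
  refine Finset.sum_congr rfl fun k _ => ?_
  by_cases hk : k = i
  · subst hk; simp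
  · simp [hk]

/-- The approximant deletes `ζ i` and adds `T i i`, the mean of the deleted diagonal term when `E ‖ζ
i‖² = 1`. What remains is a centred diagonal term and two linear forms in the other entries, each
times `ζ i` or its conjugate. -/
theorem quadForm_sub_update_zero (T : Matrix I I ℂ) (ζ : I → ℂ) (i : I) :
    star ζ ⬝ᵥ T.mulVec ζ -
        (star (Function.update ζ i 0) ⬝ᵥ T.mulVec (Function.update ζ i 0) + T i i) =
      T i i * ((‖ζ i‖ ^ 2 - 1 : ℝ) : ℂ) + star (ζ i) * (Function.update (T i) i 0 ⬝ᵥ ζ) +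
        star (Function.update (fun k => star (T k i)) i 0 ⬝ᵥ ζ) * ζ i := by
  have hζ : ζ = Function.update ζ i 0 + Pi.single i (ζ i) := by
    funext k
    by_cases hk : k = i
    · subst hk; simp
    · simp [hk]
  have e1 : Function.update (T i) i 0 ⬝ᵥ ζ = T.mulVec (Function.update ζ i 0) i :=
    (dotProduct_update_zero _ _ _).symm
  have e2 : star (Function.update (fun k => star (T k i)) i 0 ⬝ᵥ ζ) =
      star (Function.update ζ i 0) ⬝ᵥ T.col i := by
    rw [← dotProduct_update_zero, ← Matrix.star_dotProduct_star]
    congr 1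
    funext k
    simp [Matrix.col_apply]
  rw [e1, e2]
  have e3 : ((‖ζ i‖ ^ 2 - 1 : ℝ) : ℂ) = star (ζ i) * ζ i - 1 := by
    rw [Complex.star_def, Complex.conj_mul']; push_cast; ring
  rw [e3]
  generalize Function.update ζ i 0 = w at *
  generalize ζ i = s at *
  subst hζ
  have e4 : star (Pi.single i s : I → ℂ) = Pi.single i (star s) := by
    funext k
    by_cases hk : k = i
    · subst hk; simp
    · simp [hk]
  rw [star_add, Matrix.mulVec_add, dotProduct_add, add_dotProduct, add_dotProduct, e4,
    Matrix.mulVec_single, single_dotProduct, single_dotProduct, dotProduct_smul]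
  simp only [Pi.smul_apply, Matrix.col_apply, MulOpposite.smul_eq_mul_unop, MulOpposite.unop_op]
  ring

/-- Variance of a quadratic form in independent standardized entries. -/
theorem StdEntries.variance_quadForm_le (h : StdEntries μ ξ L) (T : Matrix I I ℂ) :
    ∫ y, ‖star (entryVec ξ y) ⬝ᵥ T.mulVec (entryVec ξ y) - T.trace‖ ^ 2
        ∂(Measure.pi fun _ : I => μ) ≤ 9 * L ^ 2 * (Fintype.card I * ‖T‖ ^ 2) := by
  set P := Measure.pi fun _ : I => μ
  have hf := h.bddMeas_quadForm T
  have hup : ∀ i k : I, BddMeas fun y => Function.update (entryVec ξ y) i 0 k := fun i k => by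
    by_cases hk : k = i
    · subst hk; simpa using BddMeas.const (0 : ℂ)
    · simpa [hk] using h.bddMeas_entryVec k
  have hh : ∀ i, BddMeas fun y => star (Function.update (entryVec ξ y) i 0) ⬝ᵥ
      T.mulVec (Function.update (entryVec ξ y) i 0) + T i i := fun i =>
    (BddMeas.dotProduct (f := fun y => star (Function.update (entryVec ξ y) i 0))
      (fun k => (hup i k).star) (BddMeas.mulVec (hup i) T)).add (BddMeas.const _)
  have hupd : ∀ (i : I) (y : I → Ω) (ω : Ω), Function.update (entryVec ξ (Function.update y i ω)) i 0
      = Function.update (entryVec ξ y) i 0 := fun i y ω => by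
    funext k
    by_cases hk : k = i
    · subst hk; simp
    · simp [hk, entryVec]
  have es := efronStein (ρ := μ) hf hh (fun i y ω => by simp only [hupd])
  rw [h.integral_quadForm] at es
  refine es.trans ?_
  have hterm : ∀ i ∈ Finset.univ, ∫ y, ‖star (entryVec ξ y) ⬝ᵥ T.mulVec (entryVec ξ y) -
      (star (Function.update (entryVec ξ y) i 0) ⬝ᵥ
        T.mulVec (Function.update (entryVec ξ y) i 0) + T i i)‖ ^ 2 ∂P ≤ 9 * L ^ 2 * ‖T‖ ^ 2 := by
    intro i _
    have b1 := ((h.bddMeas_entryVec i).norm.pow 2).sub (BddMeas.const (1 : ℝ)) |>.pow 2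
    have b2 := (h.bddMeas_linForm (Function.update (T i) i 0)).norm.pow 2
    have b3 := (h.bddMeas_linForm (Function.update (fun k => star (T k i)) i 0)).norm.pow 2
    have hpt : ∀ y, ‖star (entryVec ξ y) ⬝ᵥ T.mulVec (entryVec ξ y) -
      (star (Function.update (entryVec ξ y) i 0) ⬝ᵥ
        T.mulVec (Function.update (entryVec ξ y) i 0) + T i i)‖ ^ 2 ≤
        3 * ‖T‖ ^ 2 * (‖entryVec ξ y i‖ ^ 2 - 1) ^ 2 +
        (3 * L ^ 2 * ‖Function.update (T i) i 0 ⬝ᵥ entryVec ξ y‖ ^ 2 +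
        3 * L ^ 2 * ‖Function.update (fun k => star (T k i)) i 0 ⬝ᵥ entryVec ξ y‖ ^ 2) := fun y => by
      rw [quadForm_sub_update_zero]
      have hs : ‖entryVec ξ y i‖ ≤ L := h.bound i _
      have hT := norm_entry_le T i i
      have hT0 := norm_nonneg (T i i)
      have hs0 := norm_nonneg (entryVec ξ y i)
      have n1 : ‖T i i * ((‖entryVec ξ y i‖ ^ 2 - 1 : ℝ) : ℂ)‖ ≤
          ‖T‖ * |‖entryVec ξ y i‖ ^ 2 - 1| := by
        rw [norm_mul, Complex.norm_real, Real.norm_eq_abs]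
        gcongr
      have n2 : ‖star (entryVec ξ y i) * (Function.update (T i) i 0 ⬝ᵥ entryVec ξ y)‖ ≤
          L * ‖Function.update (T i) i 0 ⬝ᵥ entryVec ξ y‖ := by
        rw [norm_mul, norm_star]; gcongr
      have n3 : ‖star (Function.update (fun k => star (T k i)) i 0 ⬝ᵥ entryVec ξ y) *
          entryVec ξ y i‖ ≤
          L * ‖Function.update (fun k => star (T k i)) i 0 ⬝ᵥ entryVec ξ y‖ := by
        rw [norm_mul, norm_star, mul_comm]; gcongr
      have n4 := (norm_add₃_le (a := T i i * ((‖entryVec ξ y i‖ ^ 2 - 1 : ℝ) : ℂ))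
        (b := star (entryVec ξ y i) * (Function.update (T i) i 0 ⬝ᵥ entryVec ξ y))
        (c := star (Function.update (fun k => star (T k i)) i 0 ⬝ᵥ entryVec ξ y) *
          entryVec ξ y i)).trans (add_le_add (add_le_add n1 n2) n3)
      have n5 := pow_le_pow_left₀ (norm_nonneg _) n4 2
      have n6 : ∀ a b c : ℝ, (a + b + c) ^ 2 ≤ 3 * (a ^ 2 + b ^ 2 + c ^ 2) := fun a b c => by
        nlinarith [sq_nonneg (a - b), sq_nonneg (b - c), sq_nonneg (a - c)]
      refine (n5.trans (n6 _ _ _)).trans (le_of_eq ?_)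
      simp only [mul_pow, sq_abs]
      ring
    have i1 := (BddMeas.const (3 * ‖T‖ ^ 2)).mul b1
    have i2 := (BddMeas.const (3 * L ^ 2)).mul b2
    have i3 := (BddMeas.const (3 * L ^ 2)).mul b3
    refine (integral_mono (((hf.sub (hh i)).norm.pow 2).integrable P) ((i1.add (i2.add i3)).integrable P)
      hpt).trans ?_
    rw [integral_add (i1.integrable P) ((i2.add i3).integrable P),
      integral_add (i2.integrable P) (i3.integrable P)]
    simp only [integral_const_mul]
    rw [h.integral_norm_linForm_sq, h.integral_norm_linForm_sq]
    have r1 : l2 (Function.update (T i) i 0) ^ 2 ≤ ‖T‖ ^ 2 := by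
      refine (l2_update_zero_sq_le _ _).trans ?_
      rw [l2_sq]; exact sum_sq_row_le T i
    have r2 : l2 (Function.update (fun k => star (T k i)) i 0) ^ 2 ≤ ‖T‖ ^ 2 := by
      refine (l2_update_zero_sq_le _ _).trans ?_
      rw [l2_sq]; simpa using sum_sq_col_le T i
    have r3 := h.integral_sq_norm_sq_sub_one_le i
    -- The diagonal, row and column terms contribute 3 each, from `(a + b + c)² ≤ 3(a² + b² + c²)`.
    calc _ ≤ 3 * ‖T‖ ^ 2 * L ^ 2 + (3 * L ^ 2 * ‖T‖ ^ 2 + 3 * L ^ 2 * ‖T‖ ^ 2) := by gcongr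
      _ = _ := by ring
  refine (Finset.sum_le_sum hterm).trans (le_of_eq ?_)
  rw [Finset.sum_const, Finset.card_univ, nsmul_eq_mul]
  ring

end QuadraticForm

/-! ### The candidate equivalent and the resolvent identity. -/

section Outer

variable {m I : Type*} [Fintype m] [DecidableEq m] [Fintype I] [DecidableEq I] {n : ℕ}

/-- The matrix `-z I + (1/n) ∑ⱼ dⱼ Gⱼ Gⱼᴴ`. -/
def outerOf (G : Fin n → Matrix m I ℂ) (d : Fin n → ℂ) (z : ℂ) : Matrix m m ℂ :=
  -(z • (1 : Matrix m m ℂ)) + (1 / (n : ℂ)) • ∑ j, d j • (G j * (G j).conjTranspose)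

theorem form_mul_conjTranspose (G : Matrix m I ℂ) (u : m → ℂ) :
    star u ⬝ᵥ (G * G.conjTranspose).mulVec u = ((l2 (G.conjTranspose.mulVec u) ^ 2 : ℝ) : ℂ) := by
  rw [← star_dotProduct_self, Matrix.star_mulVec, Matrix.conjTranspose_conjTranspose,
    ← Matrix.dotProduct_mulVec, Matrix.mulVec_mulVec]

theorem isUnit_outerOf (G : Fin n → Matrix m I ℂ) {d : Fin n → ℂ} {z : ℂ} (hz : 0 < z.im)
    (hd : ∀ j, (d j).im ≤ 0) :
    IsUnit (outerOf G d z) ∧ ‖(outerOf G d z)⁻¹‖ ≤ 1 / z.im := by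
  refine isUnit_of_im_form hz fun u => ?_
  rw [outerOf, Matrix.add_mulVec, Matrix.neg_mulVec, Matrix.smul_mulVec, Matrix.smul_mulVec,
    Matrix.one_mulVec, Matrix.sum_mulVec, dotProduct_add, dotProduct_neg, dotProduct_smul,
    dotProduct_smul, dotProduct_sum, star_dotProduct_self]
  simp only [Matrix.smul_mulVec, dotProduct_smul, form_mul_conjTranspose, smul_eq_mul]
  rw [one_div, ← Complex.ofReal_natCast, ← Complex.ofReal_inv, Complex.add_im,
    Complex.im_ofReal_mul, Complex.im_sum, Complex.neg_im, Complex.im_mul_ofReal]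
  simp only [Complex.im_mul_ofReal]
  have h1 : ∑ j, (d j).im * l2 ((G j).conjTranspose.mulVec u) ^ 2 ≤ 0 :=
    Finset.sum_nonpos fun j _ => mul_nonpos_of_nonpos_of_nonneg (hd j) (sq_nonneg _)
  have h2 : ((n : ℝ)⁻¹) * ∑ j, (d j).im * l2 ((G j).conjTranspose.mulVec u) ^ 2 ≤ 0 :=
    mul_nonpos_of_nonneg_of_nonpos (by positivity) h1
  linarith

/-- The exact error when the resolvent is compared with `(outerOf G d z)⁻¹`. -/
theorem trace_res_sub_trace_outerOf_inv (G : Fin n → Matrix m I ℂ) {d : Fin n → ℂ} {z : ℂ}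
    (hz : 0 < z.im) (hd : ∀ j, (d j).im ≤ 0) (W : Fin n → m → ℂ) (M : Matrix m m ℂ) :
    (res W z * M).trace - ((outerOf G d z)⁻¹ * M).trace =
      1 / (n : ℂ) * ∑ j, (d j * (res W z *
          ((G j * (G j).conjTranspose) * ((outerOf G d z)⁻¹ * M))).trace -
        (1 + 1 / (n : ℂ) * (star (W j) ⬝ᵥ (res (Function.update W j 0) z).mulVec (W j)))⁻¹ *
          (star (W j) ⬝ᵥ
            (((outerOf G d z)⁻¹ * M) * res (Function.update W j 0) z).mulVec (W j))) := by
  set D := (outerOf G d z)⁻¹ with hD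
  have h1 : res W z * (gram W - z • (1 : Matrix m m ℂ)) = 1 :=
    Matrix.nonsing_inv_mul _ (isUnit_det_sub_smul_one (gram_posSemidef W) hz)
  have h2 : outerOf G d z * D = 1 :=
    Matrix.mul_nonsing_inv _ ((Matrix.isUnit_iff_isUnit_det _).1 (isUnit_outerOf G hz hd).1)
  -- Resolvent identity `Q - D = Q (D⁻¹ - Q⁻¹) D`; the terms in `z` cancel and a sum over columns
  -- remains.
  have e : res W z - D = res W z * (outerOf G d z - (gram W - z • (1 : Matrix m m ℂ))) * D := by
    rw [Matrix.mul_sub, Matrix.sub_mul, h1, Matrix.mul_assoc, h2, Matrix.mul_one, Matrix.one_mul]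
  have e2 : outerOf G d z - (gram W - z • (1 : Matrix m m ℂ)) =
      (1 / (n : ℂ)) • ∑ j, (d j • (G j * (G j).conjTranspose) -
        Matrix.vecMulVec (W j) (star (W j))) := by
    rw [outerOf, gram, Finset.sum_sub_distrib, smul_sub]
    abel
  rw [← Matrix.trace_sub, ← Matrix.sub_mul, e, e2, Matrix.mul_smul, Matrix.smul_mul,
    Matrix.smul_mul, Matrix.trace_smul, smul_eq_mul, Matrix.mul_assoc, Matrix.mul_assoc,
    Matrix.sum_mul, Matrix.mul_sum, Matrix.trace_sum]
  congr 1
  refine Finset.sum_congr rfl fun j _ => ?_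
  rw [Matrix.sub_mul, Matrix.mul_sub, Matrix.trace_sub, Matrix.smul_mul, Matrix.mul_smul,
    Matrix.trace_smul, smul_eq_mul]
  congr 1
  -- Cyclicity makes the rank-one term a form in `Q x_j`, where Sherman–Morrison replaces `Q` by the
  -- resolvent without column `j`.
  rw [← Matrix.mul_assoc, Matrix.mul_vecMulVec, Matrix.trace_mul_comm, Matrix.mul_vecMulVec,
    Matrix.trace_vecMulVec, res_mulVec_col hz, Matrix.mulVec_smul, smul_dotProduct, smul_eq_mul,
    Matrix.mulVec_mulVec, dotProduct_comm (Matrix.mulVec (D * M * _) _)]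

end Outer

/-! ### Independent columns: concentration and bias. -/

section Model

variable {m I Ω : Type*} [Fintype m] [DecidableEq m] [Fintype I] [DecidableEq I]
  [MeasurableSpace Ω] {n : ℕ}

/-- The columns `Gⱼ ζⱼ` of the data matrix. -/
def cols (G : Fin n → Matrix m I ℂ) (ξ : Fin n → I → Ω → ℂ) (x : Fin n → I → Ω) :
    Fin n → m → ℂ :=
  fun j => (G j).mulVec (entryVec (ξ j) (x j))

theorem cols_update (G : Fin n → Matrix m I ℂ) (ξ : Fin n → I → Ω → ℂ) (x : Fin n → I → Ω)
    (j : Fin n) (y : I → Ω) :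
    cols G ξ (Function.update x j y) =
      Function.update (cols G ξ x) j ((G j).mulVec (entryVec (ξ j) y)) := by
  funext k
  by_cases hk : k = j
  · subst hk; simp [cols]
  · simp [cols, hk]

theorem update_cols_update (G : Fin n → Matrix m I ℂ) (ξ : Fin n → I → Ω → ℂ)
    (x : Fin n → I → Ω) (j : Fin n) (y : I → Ω) :
    Function.update (cols G ξ (Function.update x j y)) j 0 =
      Function.update (cols G ξ x) j 0 := by
  rw [cols_update, Function.update_idem]

/-- The law of independent columns with independent entries. -/
def prodLaw (n : ℕ) (I : Type*) [Fintype I] (μ : Measure Ω) : Measure (Fin n → I → Ω) :=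
  Measure.pi fun _ : Fin n => Measure.pi fun _ : I => μ

variable {μ : Measure Ω} [IsProbabilityMeasure μ] {G : Fin n → Matrix m I ℂ}
  {ξ : Fin n → I → Ω → ℂ} {L : ℝ} {z : ℂ}

instance : IsProbabilityMeasure (prodLaw n I μ) := by unfold prodLaw; infer_instance

theorem bddMeas_cols (h : ∀ j, StdEntries μ (ξ j) L) (j : Fin n) (a : m) :
    BddMeas fun x => cols G ξ x j a :=
  BddMeas.mulVec (fun i => ((h j).bddMeas_entryVec i).comp (measurable_pi_apply j)) (G j) a

theorem measurable_cols (h : ∀ j, StdEntries μ (ξ j) L) : Measurable (cols G ξ) :=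
  measurable_pi_lambda _ fun j => measurable_pi_lambda _ fun a => (bddMeas_cols h j a).measurable

theorem measurable_update_cols (h : ∀ j, StdEntries μ (ξ j) L) (j : Fin n) :
    Measurable fun x => Function.update (cols G ξ x) j 0 := by
  refine measurable_pi_lambda _ fun k => ?_
  by_cases hk : k = j
  · subst hk; simp
  · simp only [Function.update_of_ne hk]
    exact (measurable_pi_apply k).comp (measurable_cols (G := G) h)

theorem bddMeas_trace_res (hz : 0 < z.im) (M : Matrix m m ℂ) :
    BddMeas fun W : Fin n → m → ℂ => (res W z * M).trace :=
  ⟨(continuous_trace_res hz M).measurable, _, fun W => norm_trace_res_mul_le hz W M⟩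

theorem bddMeas_res_apply (hz : 0 < z.im) (a b : m) :
    BddMeas fun W : Fin n → m → ℂ => res W z a b :=
  ⟨((continuous_res hz).matrix_elem a b).measurable, _,
    fun W => (norm_entry_le _ a b).trans (norm_res_le hz W)⟩

/-- Variance bound for linear statistics of the resolvent. -/
theorem variance_trace_res_le (h : ∀ j, StdEntries μ (ξ j) L) (hz : 0 < z.im)
    (M : Matrix m m ℂ) :
    ∫ x, ‖(res (cols G ξ x) z * M).trace -
        ∫ w, (res (cols G ξ w) z * M).trace ∂(prodLaw n I μ)‖ ^ 2 ∂(prodLaw n I μ) ≤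
      n * (2 / z.im * ‖M‖) ^ 2 := by
  have := variance_le_of_bounded_differences (ρ := Measure.pi fun _ : I => μ)
    ((bddMeas_trace_res hz M).comp (measurable_cols (G := G) h))
    (fun j => (bddMeas_trace_res hz M).comp (measurable_update_cols (G := G) h j))
    (fun j x y => by rw [update_cols_update])
    (fun j x => norm_trace_res_sub_le hz (cols G ξ x) j M)
  rw [Fintype.card_fin] at this
  exact this

/-- Fourth moment bound for linear statistics of the resolvent. -/
theorem fourth_moment_trace_res_le (h : ∀ j, StdEntries μ (ξ j) L) (hz : 0 < z.im)
    (M : Matrix m m ℂ) :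
    ∫ x, ‖(res (cols G ξ x) z * M).trace -
        ∫ w, (res (cols G ξ w) z * M).trace ∂(prodLaw n I μ)‖ ^ 4 ∂(prodLaw n I μ) ≤
      11 * (n : ℝ) ^ 2 * (2 / z.im * ‖M‖) ^ 4 := by
  have := fourth_moment_le_of_bounded_differences (ρ := Measure.pi fun _ : I => μ)
    ((bddMeas_trace_res hz M).comp (measurable_cols (G := G) h))
    (fun j => (bddMeas_trace_res hz M).comp (measurable_update_cols (G := G) h j))
    (fun j x y => by rw [update_cols_update])
    (fun j x => norm_trace_res_sub_le hz (cols G ξ x) j M)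
  rw [Fintype.card_fin] at this
  exact this

/-- The quadratic form `xⱼᴴ N Q₍ⱼ₎ xⱼ`, where `Q₍ⱼ₎` is the resolvent without the column `j`. -/
def looForm (G : Fin n → Matrix m I ℂ) (ξ : Fin n → I → Ω → ℂ) (z : ℂ) (N : Matrix m m ℂ)
    (j : Fin n) (x : Fin n → I → Ω) : ℂ :=
  star (cols G ξ x j) ⬝ᵥ (N * res (Function.update (cols G ξ x) j 0) z).mulVec (cols G ξ x j)

/-- The matrix of `looForm` as a form in the entries of the column `j`. -/
def looMatrix (G : Fin n → Matrix m I ℂ) (ξ : Fin n → I → Ω → ℂ) (z : ℂ) (N : Matrix m m ℂ)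
    (j : Fin n) (x : Fin n → I → Ω) : Matrix I I ℂ :=
  (G j).conjTranspose * (N * res (Function.update (cols G ξ x) j 0) z) * G j

/-- The leave-one-out resolvent ignores column `j`, so redrawing that column gives a quadratic form
with a frozen matrix. Conditioning on the other columns thus becomes `avg` over coordinate `j`. -/
theorem looForm_update (N : Matrix m m ℂ) (j : Fin n) (x : Fin n → I → Ω) (y : I → Ω) :
    looForm G ξ z N j (Function.update x j y) =
      star (entryVec (ξ j) y) ⬝ᵥ (looMatrix G ξ z N j x).mulVec (entryVec (ξ j) y) := by
  rw [looForm, looMatrix, update_cols_update, cols_update, Function.update_self,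
    Matrix.star_mulVec, ← Matrix.dotProduct_mulVec, Matrix.mulVec_mulVec, Matrix.mulVec_mulVec,
    Matrix.mul_assoc]

theorem trace_looMatrix (N : Matrix m m ℂ) (j : Fin n) (x : Fin n → I → Ω) :
    (looMatrix G ξ z N j x).trace =
      (res (Function.update (cols G ξ x) j 0) z * ((G j * (G j).conjTranspose) * N)).trace := by
  rw [looMatrix, Matrix.mul_assoc, Matrix.trace_mul_comm, Matrix.mul_assoc, Matrix.mul_assoc,
    Matrix.trace_mul_comm, Matrix.mul_assoc, Matrix.trace_mul_comm]

theorem looMatrix_update (N : Matrix m m ℂ) (j : Fin n) (x : Fin n → I → Ω) (y : I → Ω) :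
    looMatrix G ξ z N j (Function.update x j y) = looMatrix G ξ z N j x := by
  rw [looMatrix, update_cols_update, looMatrix]

theorem bddMeas_trace_looMatrix (h : ∀ j, StdEntries μ (ξ j) L) (hz : 0 < z.im)
    (N : Matrix m m ℂ) (j : Fin n) : BddMeas fun x => (looMatrix G ξ z N j x).trace := by
  simp only [trace_looMatrix]
  exact (bddMeas_trace_res hz _).comp (measurable_update_cols (G := G) h j)

theorem bddMeas_looForm (h : ∀ j, StdEntries μ (ξ j) L) (hz : 0 < z.im) (N : Matrix m m ℂ)
    (j : Fin n) : BddMeas (looForm G ξ z N j) := by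
  refine BddMeas.dotProduct (f := fun x => star (cols G ξ x j))
    (fun a => (bddMeas_cols h j a).star) fun a => ?_
  refine BddMeas.dotProduct
    (f := fun x => (N * res (Function.update (cols G ξ x) j 0) z) a) (fun b => ?_)
    (bddMeas_cols h j)
  refine BddMeas.dotProduct (f := fun _ => N a)
    (g := fun x c => res (Function.update (cols G ξ x) j 0) z c b) (fun _ => BddMeas.const _)
    fun c => ?_
  exact (bddMeas_res_apply hz c b).comp (measurable_update_cols h j)

theorem norm_looMatrix_le (hz : 0 < z.im) {σ : ℝ} (hG : ∀ j, ‖G j‖ ^ 2 ≤ σ) (N : Matrix m m ℂ)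
    (j : Fin n) (x : Fin n → I → Ω) : ‖looMatrix G ξ z N j x‖ ≤ σ * ‖N‖ / z.im := by
  have h1 := norm_res_le hz (Function.update (cols G ξ x) j 0)
  calc ‖looMatrix G ξ z N j x‖
      ≤ ‖(G j).conjTranspose * (N * res (Function.update (cols G ξ x) j 0) z)‖ * ‖G j‖ :=
        Matrix.l2_opNorm_mul _ _
    _ ≤ (‖(G j).conjTranspose‖ * ‖N * res (Function.update (cols G ξ x) j 0) z‖) * ‖G j‖ := by
        gcongr; exact Matrix.l2_opNorm_mul _ _
    _ ≤ (‖G j‖ * (‖N‖ * (1 / z.im))) * ‖G j‖ := by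
        rw [Matrix.l2_opNorm_conjTranspose]
        gcongr
        refine (norm_mul_le _ _).trans ?_
        gcongr
    _ = ‖G j‖ ^ 2 * (‖N‖ / z.im) := by ring
    _ ≤ σ * (‖N‖ / z.im) := by gcongr; exact hG j
    _ = _ := by ring

theorem integral_looForm (h : ∀ j, StdEntries μ (ξ j) L) (hz : 0 < z.im) (N : Matrix m m ℂ)
    (j : Fin n) :
    ∫ x, looForm G ξ z N j x ∂(prodLaw n I μ) =
      ∫ x, (looMatrix G ξ z N j x).trace ∂(prodLaw n I μ) := by
  rw [prodLaw, ← integral_avg (bddMeas_looForm h hz N j) j]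
  refine integral_congr_ae (Eventually.of_forall fun x => ?_)
  simp only [avg, looForm_update, (h j).integral_quadForm]

theorem integral_looForm_sub_trace_sq_le (h : ∀ j, StdEntries μ (ξ j) L) (hz : 0 < z.im) {σ : ℝ}
    (hG : ∀ j, ‖G j‖ ^ 2 ≤ σ) (N : Matrix m m ℂ) (j : Fin n) :
    ∫ x, ‖looForm G ξ z N j x - (looMatrix G ξ z N j x).trace‖ ^ 2 ∂(prodLaw n I μ) ≤
      9 * L ^ 2 * (Fintype.card I * (σ * ‖N‖ / z.im) ^ 2) := by
  have hb := ((bddMeas_looForm (G := G) h hz N j).sub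
    (bddMeas_trace_looMatrix (G := G) h hz N j)).norm.pow 2
  rw [prodLaw, ← integral_avg hb j]
  refine (integral_mono ((hb.avg j).integrable _) (integrable_const
    (9 * L ^ 2 * (Fintype.card I * (σ * ‖N‖ / z.im) ^ 2))) fun x => ?_).trans (by simp)
  simp only [avg, looForm_update, looMatrix_update]
  refine ((h j).variance_quadForm_le _).trans ?_
  gcongr
  exact norm_looMatrix_le hz hG N j x

/-- A size bound: fluctuation plus trace. It is of order `n²` once `L²` and the number of entries
are `O(n)`. -/
theorem integral_norm_looForm_sq_le (h : ∀ j, StdEntries μ (ξ j) L) (hz : 0 < z.im) {σ : ℝ}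
    (hG : ∀ j, ‖G j‖ ^ 2 ≤ σ) (N : Matrix m m ℂ) (j : Fin n) :
    ∫ x, ‖looForm G ξ z N j x‖ ^ 2 ∂(prodLaw n I μ) ≤
      (18 * L ^ 2 * Fintype.card I + 2 * (Fintype.card I : ℝ) ^ 2) * (σ * ‖N‖ / z.im) ^ 2 := by
  have hb := ((bddMeas_looForm (G := G) h hz N j).sub
    (bddMeas_trace_looMatrix (G := G) h hz N j)).norm.pow 2
  have hpt : ∀ x, ‖looForm G ξ z N j x‖ ^ 2 ≤
      2 * ‖looForm G ξ z N j x - (looMatrix G ξ z N j x).trace‖ ^ 2 +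
        2 * (Fintype.card I * (σ * ‖N‖ / z.im)) ^ 2 := fun x => by
    have h1 : ‖(looMatrix G ξ z N j x).trace‖ ≤ Fintype.card I * (σ * ‖N‖ / z.im) := by
      refine (norm_trace_le _).trans ?_
      gcongr
      exact norm_looMatrix_le hz hG N j x
    have h2 := norm_le_norm_sub_add (looForm G ξ z N j x) (looMatrix G ξ z N j x).trace
    have h3 := pow_le_pow_left₀ (norm_nonneg _) (h2.trans (add_le_add le_rfl h1)) 2
    refine h3.trans ?_
    nlinarith [sq_nonneg (‖looForm G ξ z N j x - (looMatrix G ξ z N j x).trace‖ -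
      Fintype.card I * (σ * ‖N‖ / z.im))]
  refine (integral_mono (((bddMeas_looForm h hz N j).norm.pow 2).integrable _)
    ((((BddMeas.const 2).mul hb).add (BddMeas.const _)).integrable _) hpt).trans ?_
  rw [integral_add (((BddMeas.const 2).mul hb).integrable _) (integrable_const _),
    integral_const_mul]
  have h1 := integral_looForm_sub_trace_sq_le h hz hG N j
  simp only [integral_const, probReal_univ, one_smul]
  calc _ ≤ 2 * (9 * L ^ 2 * (Fintype.card I * (σ * ‖N‖ / z.im) ^ 2)) +
        2 * (Fintype.card I * (σ * ‖N‖ / z.im)) ^ 2 := by gcongr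
    _ = _ := by ring

/-- `(1/n) E tr (Gⱼ Gⱼᴴ Q)`. -/
def meanTrace (μ : Measure Ω) (G : Fin n → Matrix m I ℂ) (ξ : Fin n → I → Ω → ℂ) (z : ℂ)
    (j : Fin n) : ℂ :=
  1 / (n : ℂ) * ∫ x, (res (cols G ξ x) z * (G j * (G j).conjTranspose)).trace ∂(prodLaw n I μ)

theorem meanTrace_im_nonneg (h : ∀ j, StdEntries μ (ξ j) L) (hz : 0 < z.im) (j : Fin n) :
    0 ≤ (meanTrace μ G ξ z j).im ∧ 0 ≤ (z * meanTrace μ G ξ z j).im := by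
  have hb : BddMeas fun x => (res (cols G ξ x) z * (G j * (G j).conjTranspose)).trace :=
    (bddMeas_trace_res hz _).comp (measurable_cols h)
  have hpos := fun x => trace_gram_mul_resolvent_im_nonneg (gram_posSemidef (cols G ξ x)) hz (G j)
  simp only [fun x => Matrix.trace_mul_comm (G j * (G j).conjTranspose)
    (gram (cols G ξ x) - z • (1 : Matrix m m ℂ))⁻¹] at hpos
  have hn : (0 : ℝ) ≤ (n : ℝ)⁻¹ := by positivity
  constructor
  · rw [meanTrace, one_div, ← Complex.ofReal_natCast, ← Complex.ofReal_inv, Complex.im_ofReal_mul]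
    refine mul_nonneg hn ?_
    have := integral_im (hb.integrable (prodLaw n I μ))
    refine le_of_le_of_eq ?_ this
    exact integral_nonneg fun x => (hpos x).1
  · rw [meanTrace, mul_left_comm, one_div, ← Complex.ofReal_natCast, ← Complex.ofReal_inv,
      Complex.im_ofReal_mul, ← integral_const_mul]
    refine mul_nonneg hn ?_
    have := integral_im (((BddMeas.const z).mul hb).integrable (prodLaw n I μ))
    refine le_of_le_of_eq ?_ this
    exact integral_nonneg fun x => (hpos x).2

/-- The deterministic equivalent for independent columns. -/
def detEquiv (μ : Measure Ω) (G : Fin n → Matrix m I ℂ) (ξ : Fin n → I → Ω → ℂ) (z : ℂ) :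
    Matrix m m ℂ :=
  (outerOf G (fun j => (1 + meanTrace μ G ξ z j)⁻¹) z)⁻¹

/-- Three errors add up: form against its conditional mean, fluctuation of the trace, and removal of
column `j`. The first gives 27 = 3 · 9, the other two 24 = 3 · (4 + 4). -/
theorem integral_looForm_sub_meanTrace_sq_le (h : ∀ j, StdEntries μ (ξ j) L) (hz : 0 < z.im)
    {σ κ : ℝ} (hG : ∀ j, ‖G j‖ ^ 2 ≤ σ) (hκ : (Fintype.card I : ℝ) ≤ κ * n) (hL : 1 ≤ L)
    (j : Fin n) :
    ∫ x, ‖1 / (n : ℂ) * looForm G ξ z 1 j x - meanTrace μ G ξ z j‖ ^ 2 ∂(prodLaw n I μ) ≤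
      (27 * κ + 24) * (σ / z.im) ^ 2 * (L ^ 2 / n) := by
  have hn : (0 : ℝ) < n := by exact_mod_cast j.pos
  set Γ := G j * (G j).conjTranspose with hΓ
  have hσ : ‖Γ‖ ≤ σ := by
    refine (Matrix.l2_opNorm_mul _ _).trans ?_
    rw [Matrix.l2_opNorm_conjTranspose, ← sq]
    exact hG j
  have hσ0 : 0 ≤ σ := (norm_nonneg _).trans hσ
  set e := ∫ x, (res (cols G ξ x) z * Γ).trace ∂(prodLaw n I μ) with he
  have b1 := ((bddMeas_looForm (G := G) h hz 1 j).sub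
    (bddMeas_trace_looMatrix (G := G) h hz 1 j)).norm.pow 2
  have b2 : BddMeas fun x => ‖(res (cols G ξ x) z * Γ).trace - e‖ ^ 2 :=
    (((bddMeas_trace_res hz _).comp (measurable_cols h)).sub (BddMeas.const _)).norm.pow 2
  have b0 : BddMeas fun x => ‖1 / (n : ℂ) * looForm G ξ z 1 j x - meanTrace μ G ξ z j‖ ^ 2 :=
    (((BddMeas.const _).mul (bddMeas_looForm h hz 1 j)).sub (BddMeas.const _)).norm.pow 2
  have hpt : ∀ x, ‖1 / (n : ℂ) * looForm G ξ z 1 j x - meanTrace μ G ξ z j‖ ^ 2 ≤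
      3 / (n : ℝ) ^ 2 * (‖looForm G ξ z 1 j x - (looMatrix G ξ z 1 j x).trace‖ ^ 2 +
        (‖(res (cols G ξ x) z * Γ).trace - e‖ ^ 2 + (2 / z.im * σ) ^ 2)) := fun x => by
    have e1 : 1 / (n : ℂ) * looForm G ξ z 1 j x - meanTrace μ G ξ z j =
      1 / (n : ℂ) * ((looForm G ξ z 1 j x - (looMatrix G ξ z 1 j x).trace) +
        ((res (cols G ξ x) z * Γ).trace - e) +
        (-((res (cols G ξ x) z * Γ).trace - (looMatrix G ξ z 1 j x).trace))) := by
      rw [meanTrace]; ring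
    have e2 : ‖(res (cols G ξ x) z * Γ).trace - (looMatrix G ξ z 1 j x).trace‖ ≤
        2 / z.im * σ := by
      rw [trace_looMatrix, Matrix.mul_one]
      refine (norm_trace_res_sub_le hz _ _ _).trans ?_
      gcongr
    have e3 := norm_add₃_le (a := looForm G ξ z 1 j x - (looMatrix G ξ z 1 j x).trace)
      (b := (res (cols G ξ x) z * Γ).trace - e)
      (c := -((res (cols G ξ x) z * Γ).trace - (looMatrix G ξ z 1 j x).trace))
    rw [norm_neg] at e3
    have e4 := pow_le_pow_left₀ (norm_nonneg _) (e3.trans (add_le_add le_rfl e2)) 2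
    have n6 : ∀ a b c : ℝ, (a + b + c) ^ 2 ≤ 3 * (a ^ 2 + (b ^ 2 + c ^ 2)) := fun a b c => by
      nlinarith [sq_nonneg (a - b), sq_nonneg (b - c), sq_nonneg (a - c)]
    rw [e1, norm_mul, mul_pow]
    have e5 : ‖1 / (n : ℂ)‖ ^ 2 = 1 / (n : ℝ) ^ 2 := by simp
    rw [e5]
    calc _ ≤ 1 / (n : ℝ) ^ 2 * (3 * (‖looForm G ξ z 1 j x - (looMatrix G ξ z 1 j x).trace‖ ^ 2 +
        (‖(res (cols G ξ x) z * Γ).trace - e‖ ^ 2 + (2 / z.im * σ) ^ 2))) := by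
          gcongr; exact e4.trans (n6 _ _ _)
      _ = _ := by ring
  refine (integral_mono (b0.integrable _) (((BddMeas.const _).mul
    (b1.add (b2.add (BddMeas.const _)))).integrable _) hpt).trans ?_
  rw [integral_const_mul, integral_add (b1.integrable _)
    ((b2.add (BddMeas.const _)).integrable _), integral_add (b2.integrable _) (integrable_const _)]
  have v1 := integral_looForm_sub_trace_sq_le h hz hG 1 j
  have v2 := variance_trace_res_le (G := G) h hz Γ
  -- Only an inequality, since `m` may be empty.
  have hone : ‖(1 : Matrix m m ℂ)‖ ≤ 1 := by
    refine opNorm_le_of_l2 zero_le_one fun u => by simp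
  simp only [integral_const, probReal_univ, one_smul]
  have hL2 : 1 ≤ L ^ 2 := one_le_pow₀ hL
  have hn1 : (1 : ℝ) ≤ n := by exact_mod_cast j.pos
  have w1 : 9 * L ^ 2 * (Fintype.card I * (σ * ‖(1 : Matrix m m ℂ)‖ / z.im) ^ 2) ≤
      9 * L ^ 2 * ((κ * n) * (σ / z.im) ^ 2) := by
    have : σ * ‖(1 : Matrix m m ℂ)‖ / z.im ≤ σ / z.im := by
      gcongr; exact mul_le_of_le_one_right hσ0 hone
    have : 0 ≤ κ * n := (Nat.cast_nonneg _).trans hκ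
    gcongr
  have w2 : (n : ℝ) * (2 / z.im * ‖Γ‖) ^ 2 ≤ n * (2 / z.im * σ) ^ 2 := by gcongr
  calc _ ≤ 3 / (n : ℝ) ^ 2 * (9 * L ^ 2 * ((κ * n) * (σ / z.im) ^ 2) +
        (n * (2 / z.im * σ) ^ 2 + n * (2 / z.im * σ) ^ 2)) := by
          gcongr
          · exact v1.trans w1
          · exact v2.trans w2
          · exact le_mul_of_one_le_left (sq_nonneg _) hn1
    _ = (27 * κ * L ^ 2 + 24) * (σ / z.im) ^ 2 / n := by field_simp; ring
    _ ≤ (27 * κ * L ^ 2 + 24 * L ^ 2) * (σ / z.im) ^ 2 / n := by gcongr; linarith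
    _ = _ := by ring

/-- The constant in the bias estimate. -/
def biasConst (σ M v ζ κ : ℝ) : ℝ :=
  ζ / v * (2 / v * (σ * (M / v))) + (ζ / v) ^ 2 * (((18 * κ + 2 * κ ^ 2) *
    (σ * (M / v) / v) ^ 2 + (27 * κ + 24) * (σ / v) ^ 2) / 2)

/-- The expected resolvent is close to the deterministic equivalent. -/
theorem norm_integral_trace_res_sub_le (h : ∀ j, StdEntries μ (ξ j) L) (hz : 0 < z.im)
    {σ κ C : ℝ} (hσ0 : 0 ≤ σ) (hG : ∀ j, ‖G j‖ ^ 2 ≤ σ)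
    (hκ : (Fintype.card I : ℝ) ≤ κ * n) (hn : 0 < n) (hL : 1 ≤ L) (hLn : L ^ 2 ≤ n)
    (M : Matrix m m ℂ) (hM : ‖M‖ ≤ C) :
    ‖∫ x, (res (cols G ξ x) z * M).trace ∂(prodLaw n I μ) - (detEquiv μ G ξ z * M).trace‖ ≤
      biasConst σ C z.im ‖z‖ κ * (L * √n) := by
  set P := prodLaw n I μ
  set d : Fin n → ℂ := fun j => (1 + meanTrace μ G ξ z j)⁻¹ with hd
  have hdim : ∀ j, (d j).im ≤ 0 := fun j => inv_one_add_im_nonpos (meanTrace_im_nonneg h hz j).1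
  have hdn : ∀ j, ‖d j‖ ≤ ‖z‖ / z.im := fun j =>
    norm_inv_one_add_le hz (meanTrace_im_nonneg h hz j).2
  have hn' : (0 : ℝ) < n := by exact_mod_cast hn
  have hn1 : (1 : ℝ) ≤ n := by exact_mod_cast hn
  have hC0 : 0 ≤ C := (norm_nonneg _).trans hM
  have hκ0 : 0 ≤ κ := by
    have := (Nat.cast_nonneg (α := ℝ) (Fintype.card I)).trans hκ
    exact nonneg_of_mul_nonneg_left this hn'
  set N := detEquiv μ G ξ z * M with hN
  have hNn : ‖N‖ ≤ C / z.im := by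
    refine (norm_mul_le _ _).trans ?_
    calc _ ≤ 1 / z.im * C := by gcongr; exact (isUnit_outerOf G hz hdim).2
      _ = _ := by ring
  have hΓn : ∀ j, ‖(G j * (G j).conjTranspose) * N‖ ≤ σ * (C / z.im) := fun j => by
    refine (norm_mul_le _ _).trans ?_
    gcongr
    refine (Matrix.l2_opNorm_mul _ _).trans ?_
    rw [Matrix.l2_opNorm_conjTranspose, ← sq]
    exact hG j
  set α : Fin n → (Fin n → I → Ω) → ℂ := fun j x => 1 / (n : ℂ) * looForm G ξ z 1 j x with hα
  have hαim : ∀ j x, 0 ≤ (z * α j x).im := fun j x => by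
    have := (form_resolvent_im_nonneg (gram_posSemidef (Function.update (cols G ξ x) j 0)) hz
      (cols G ξ x j)).2
    simp only [hα, looForm, Matrix.one_mul]
    rw [mul_left_comm, one_div, ← Complex.ofReal_natCast, ← Complex.ofReal_inv,
      Complex.im_ofReal_mul]
    exact mul_nonneg (by positivity) this
  have hid : ∀ x, (res (cols G ξ x) z * M).trace - N.trace = 1 / (n : ℂ) * ∑ j,
      (d j * (res (cols G ξ x) z * ((G j * (G j).conjTranspose) * N)).trace -
        (1 + α j x)⁻¹ * looForm G ξ z N j x) := fun x => by
    have := trace_res_sub_trace_outerOf_inv G hz hdim (cols G ξ x) M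
    simp only [hα, looForm, Matrix.one_mul]
    exact this
  have bT : ∀ A : Matrix m m ℂ, BddMeas fun x => (res (cols G ξ x) z * A).trace := fun A =>
    (bddMeas_trace_res hz _).comp (measurable_cols h)
  have bβ : ∀ j, BddMeas (looForm G ξ z N j) := fun j => bddMeas_looForm h hz N j
  have bα : ∀ j, BddMeas (α j) := fun j => (BddMeas.const _).mul (bddMeas_looForm h hz 1 j)
  have bL : ∀ j, BddMeas fun x => (looMatrix G ξ z N j x).trace := fun j =>
    bddMeas_trace_looMatrix h hz N j
  have bI : ∀ j, BddMeas fun x => (1 + α j x)⁻¹ := fun j =>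
    ⟨(measurable_const.add (bα j).measurable).inv, _,
      fun x => norm_inv_one_add_le hz (hαim j x)⟩
  have bterm : ∀ j, BddMeas fun x =>
      d j * (res (cols G ξ x) z * ((G j * (G j).conjTranspose) * N)).trace -
        (1 + α j x)⁻¹ * looForm G ξ z N j x := fun j =>
    ((BddMeas.const _).mul (bT _)).sub ((bI j).mul (bβ j))
  have key : ∀ j ∈ Finset.univ, ‖∫ x,
      (d j * (res (cols G ξ x) z * ((G j * (G j).conjTranspose) * N)).trace -
        (1 + α j x)⁻¹ * looForm G ξ z N j x) ∂P‖ ≤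
      biasConst σ C z.im ‖z‖ κ * (L * √n) := by
    intro j _
    have b1 : BddMeas fun x => d j *
        ((res (cols G ξ x) z * ((G j * (G j).conjTranspose) * N)).trace -
          (looMatrix G ξ z N j x).trace) := (BddMeas.const _).mul ((bT _).sub (bL j))
    have b2 : BddMeas fun x => d j * ((looMatrix G ξ z N j x).trace - looForm G ξ z N j x) :=
      (BddMeas.const _).mul ((bL j).sub (bβ j))
    have b3 : BddMeas fun x => (d j - (1 + α j x)⁻¹) * looForm G ξ z N j x :=
      ((BddMeas.const _).sub (bI j)).mul (bβ j)
    have esplit : ∫ x, (d j * (res (cols G ξ x) z * ((G j * (G j).conjTranspose) * N)).trace -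
        (1 + α j x)⁻¹ * looForm G ξ z N j x) ∂P =
        ∫ x, (d j * ((res (cols G ξ x) z * ((G j * (G j).conjTranspose) * N)).trace -
          (looMatrix G ξ z N j x).trace) +
          (d j - (1 + α j x)⁻¹) * looForm G ξ z N j x) ∂P := by
      -- As `d j` is deterministic, exchanging the form for its conditional mean costs nothing in
      -- expectation.
      have hz2 : ∫ x, d j * ((looMatrix G ξ z N j x).trace - looForm G ξ z N j x) ∂P = 0 := by
        rw [integral_const_mul, integral_sub ((bL j).integrable P) ((bβ j).integrable P),
          integral_looForm h hz N j, sub_self, mul_zero]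
      have := integral_add ((b1.add b3).integrable P) (b2.integrable P)
      rw [hz2, add_zero] at this
      rw [← this]
      refine integral_congr_ae (Eventually.of_forall fun x => ?_)
      simp only
      ring
    set s : ℝ := √n with hs
    have hs0 : 0 < s := Real.sqrt_pos.2 hn'
    have hss : s ^ 2 = n := Real.sq_sqrt hn'.le
    have hs1 : 1 ≤ s := by
      rw [hs]; exact Real.one_le_sqrt.2 hn1
    -- Weight for `ab ≤ (t/2) b² + a²/(2t)`: with `E b² = O(n²)` and `E a² = O(L²/n)`, both terms
    -- become `O(L√n)`.
    set t : ℝ := L / s ^ 3 with ht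
    have ht0 : 0 < t := by positivity
    have hpt : ∀ x, ‖d j * ((res (cols G ξ x) z * ((G j * (G j).conjTranspose) * N)).trace -
          (looMatrix G ξ z N j x).trace) + (d j - (1 + α j x)⁻¹) * looForm G ξ z N j x‖ ≤
        ‖z‖ / z.im * (2 / z.im * (σ * (C / z.im))) + (‖z‖ / z.im) ^ 2 *
          ((t / 2) * ‖looForm G ξ z N j x‖ ^ 2 +
            (1 / (2 * t)) * ‖α j x - meanTrace μ G ξ z j‖ ^ 2) := fun x => by
      refine (norm_add_le _ _).trans (add_le_add ?_ ?_)
      · rw [norm_mul, trace_looMatrix]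
        gcongr
        · exact hdn j
        · refine (norm_trace_res_sub_le hz _ _ _).trans ?_
          gcongr
          exact hΓn j
      · have e1 : d j - (1 + α j x)⁻¹ =
            d j * (1 + α j x)⁻¹ * (α j x - meanTrace μ G ξ z j) := by
          have h1 := one_add_ne_zero hz (hαim j x)
          have h2 := one_add_ne_zero hz (meanTrace_im_nonneg (G := G) h hz j).2
          simp only [hd]
          field_simp
          ring
        rw [e1, norm_mul, norm_mul, norm_mul, mul_assoc]
        have e2 : ‖α j x - meanTrace μ G ξ z j‖ * ‖looForm G ξ z N j x‖ ≤
            (t / 2) * ‖looForm G ξ z N j x‖ ^ 2 +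
            (1 / (2 * t)) * ‖α j x - meanTrace μ G ξ z j‖ ^ 2 := by
          generalize ‖α j x - meanTrace μ G ξ z j‖ = a
          generalize ‖looForm G ξ z N j x‖ = b
          have : t / 2 * b ^ 2 + 1 / (2 * t) * a ^ 2 - a * b = (t * b - a) ^ 2 / (2 * t) := by
            field_simp; ring
          have h0 : 0 ≤ (t * b - a) ^ 2 / (2 * t) := by positivity
          linarith
        rw [sq (‖z‖ / z.im)]
        gcongr
        · exact hdn j
        · exact norm_inv_one_add_le hz (hαim j x)
    rw [esplit]
    have c1 : BddMeas fun x => (t / 2) * ‖looForm G ξ z N j x‖ ^ 2 :=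
      (BddMeas.const _).mul ((bβ j).norm.pow 2)
    have c2 : BddMeas fun x => (1 / (2 * t)) * ‖α j x - meanTrace μ G ξ z j‖ ^ 2 :=
      (BddMeas.const _).mul (((bα j).sub (BddMeas.const _)).norm.pow 2)
    refine (norm_integral_le_of_norm_le (((BddMeas.const _).add ((BddMeas.const _).mul
      (c1.add c2))).integrable P) (Eventually.of_forall hpt)).trans ?_
    rw [integral_add (integrable_const _) (((BddMeas.const _).mul (c1.add c2)).integrable P),
      integral_const, integral_const_mul, integral_add (c1.integrable P) (c2.integrable P),
      integral_const_mul, integral_const_mul]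
    simp only [probReal_univ, one_smul]
    have v1 := integral_norm_looForm_sq_le h hz hG N j
    have v2 := integral_looForm_sub_meanTrace_sq_le h hz hG hκ hL j
    have w1 : (18 * L ^ 2 * Fintype.card I + 2 * (Fintype.card I : ℝ) ^ 2) *
        (σ * ‖N‖ / z.im) ^ 2 ≤
        (18 * κ + 2 * κ ^ 2) * (σ * (C / z.im) / z.im) ^ 2 * s ^ 4 := by
      -- Here `L² ≤ n` makes the fluctuation no larger than the squared trace.
      calc _ ≤ (18 * n * (κ * n) + 2 * (κ * n) ^ 2) * (σ * (C / z.im) / z.im) ^ 2 := by gcongr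
        _ = _ := by rw [← hss]; ring
    have w2 : t / 2 * ∫ x, ‖looForm G ξ z N j x‖ ^ 2 ∂P ≤
        (18 * κ + 2 * κ ^ 2) * (σ * (C / z.im) / z.im) ^ 2 / 2 * (L * s) := by
      calc _ ≤ t / 2 * ((18 * κ + 2 * κ ^ 2) * (σ * (C / z.im) / z.im) ^ 2 * s ^ 4) := by
            gcongr; exact v1.trans w1
        _ = _ := by rw [ht]; field_simp
    have w3 : 1 / (2 * t) * ∫ x, ‖α j x - meanTrace μ G ξ z j‖ ^ 2 ∂P ≤
        (27 * κ + 24) * (σ / z.im) ^ 2 / 2 * (L * s) := by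
      calc _ ≤ 1 / (2 * t) * ((27 * κ + 24) * (σ / z.im) ^ 2 * (L ^ 2 / n)) := by gcongr
        _ = _ := by rw [ht, ← hss]; field_simp
    have w4 : 1 ≤ L * s := one_le_mul_of_one_le_of_one_le hL hs1
    calc _ ≤ ‖z‖ / z.im * (2 / z.im * (σ * (C / z.im))) * (L * s) + (‖z‖ / z.im) ^ 2 *
          ((18 * κ + 2 * κ ^ 2) * (σ * (C / z.im) / z.im) ^ 2 / 2 * (L * s) +
            (27 * κ + 24) * (σ / z.im) ^ 2 / 2 * (L * s)) := by
          refine add_le_add (le_mul_of_one_le_right (by positivity) w4) ?_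
          gcongr
      _ = _ := by rw [biasConst]; ring
  have hint : ∫ x, (res (cols G ξ x) z * M).trace ∂P - N.trace = 1 / (n : ℂ) * ∑ j, ∫ x,
      (d j * (res (cols G ξ x) z * ((G j * (G j).conjTranspose) * N)).trace -
        (1 + α j x)⁻¹ * looForm G ξ z N j x) ∂P := by
    rw [← integral_finsetSum _ fun j _ => (bterm j).integrable P, ← integral_const_mul]
    simp only [← hid]
    rw [integral_sub ((bT M).integrable P) (integrable_const _)]
    simp
  rw [hint, norm_mul]
  refine (mul_le_mul_of_nonneg_left ((norm_sum_le _ _).trans (Finset.sum_le_sum key))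
    (norm_nonneg _)).trans (le_of_eq ?_)
  rw [Finset.sum_const, Finset.card_univ, Fintype.card_fin, nsmul_eq_mul]
  simp only [norm_div, norm_one, Complex.norm_natCast]
  field_simp

end Model

/-! ### From the sum of separable terms to independent columns. -/

section Reduction

variable {K p n : ℕ}

theorem sqrt_eq_diagonal {B : Matrix (Fin n) (Fin n) ℂ} (hB : B.PosSemidef) (hd : B.IsDiag) :
    CFC.sqrt B = Matrix.diagonal fun j => ((√(B j j).re : ℝ) : ℂ) := by
  refine CFC.sqrt_unique ?_ ?_
  · rw [Matrix.diagonal_mul_diagonal]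
    conv_rhs => rw [← hd.diagonal_diag]
    congr 1
    funext j
    have h := Complex.le_def.1 (hB.diag_nonneg (i := j))
    rw [← Complex.ofReal_mul, Real.mul_self_sqrt h.1]
    exact Complex.ext rfl h.2
  · rw [Matrix.nonneg_iff_posSemidef, Matrix.posSemidef_diagonal_iff]
    exact fun j => Complex.zero_le_real.2 (Real.sqrt_nonneg _)

/-- The mixing matrices: the column `j` of the data matrix is `mixing A B j` applied to the vector
of the entries of all noise matrices in their column `j`. -/
def mixing (A : Fin K → Matrix (Fin p) (Fin p) ℂ) (B : Fin K → Matrix (Fin n) (Fin n) ℂ)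
    (j : Fin n) : Matrix (Fin p) (Fin K × Fin p) ℂ :=
  fun k t => CFC.sqrt (A t.1) k t.2 * ((√(B t.1 j j).re : ℝ) : ℂ)

/-- The columns of the data matrix. -/
def dataCols (A : Fin K → Matrix (Fin p) (Fin p) ℂ) (B : Fin K → Matrix (Fin n) (Fin n) ℂ)
    (Z : Fin K → Matrix (Fin p) (Fin n) ℂ) (j : Fin n) : Fin p → ℂ :=
  (mixing A B j).mulVec fun t => Z t.1 t.2 j

variable {A : Fin K → Matrix (Fin p) (Fin p) ℂ} {B : Fin K → Matrix (Fin n) (Fin n) ℂ}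

theorem dataMatrix_apply (hB : ∀ r, (B r).PosSemidef) (hBd : ∀ r, (B r).IsDiag)
    (Z : Fin K → Matrix (Fin p) (Fin n) ℂ) (k : Fin p) (j : Fin n) :
    dataMatrix A B Z k j = dataCols A B Z j k := by
  simp only [dataMatrix, dataCols, mixing, Matrix.sum_apply, Matrix.mulVec, dotProduct,
    Fintype.sum_prod_type]
  refine Finset.sum_congr rfl fun r _ => ?_
  rw [sqrt_eq_diagonal (hB r) (hBd r), Matrix.mul_diagonal, Matrix.mul_apply, Finset.sum_mul]
  refine Finset.sum_congr rfl fun i _ => by ring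

theorem sampleCov_eq_gram (hB : ∀ r, (B r).PosSemidef) (hBd : ∀ r, (B r).IsDiag)
    (Z : Fin K → Matrix (Fin p) (Fin n) ℂ) : sampleCov A B Z = gram (dataCols A B Z) := by
  rw [sampleCov, gram]
  congr 1
  ext a b
  simp only [Matrix.mul_apply, Matrix.conjTranspose_apply, dataMatrix_apply hB hBd,
    Matrix.sum_apply, Matrix.vecMulVec_apply, Pi.star_apply]

theorem resolvent_eq_res (hB : ∀ r, (B r).PosSemidef) (hBd : ∀ r, (B r).IsDiag)
    (Z : Fin K → Matrix (Fin p) (Fin n) ℂ) (z : ℂ) :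
    resolvent A B Z z = res (dataCols A B Z) z := by
  rw [resolvent, res, sampleCov_eq_gram hB hBd]

/-- Identifies the covariance `Γ_j` of column `j`; the square roots enter only through their
squares. -/
theorem mixing_mul_conjTranspose (hA : ∀ r, (A r).PosSemidef) (hB : ∀ r, (B r).PosSemidef)
    (j : Fin n) :
    mixing A B j * (mixing A B j).conjTranspose = ∑ r, B r j j • A r := by
  ext a b
  simp only [Matrix.mul_apply, Matrix.conjTranspose_apply, mixing, Fintype.sum_prod_type,
    Matrix.sum_apply, Matrix.smul_apply, smul_eq_mul]
  refine Finset.sum_congr rfl fun r _ => ?_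
  have hr : (CFC.sqrt (A r)).IsHermitian :=
    (Matrix.nonneg_iff_posSemidef.1 (CFC.sqrt_nonneg (A r))).isHermitian
  have h1 : A r a b = ∑ i, CFC.sqrt (A r) a i * star (CFC.sqrt (A r) b i) := by
    conv_lhs => rw [← CFC.sqrt_mul_sqrt_self (A r) (Matrix.nonneg_iff_posSemidef.2 (hA r))]
    rw [Matrix.mul_apply]
    refine Finset.sum_congr rfl fun i _ => ?_
    rw [hr.apply i b]
  have h2 : B r j j = ((√(B r j j).re : ℝ) : ℂ) * ((√(B r j j).re : ℝ) : ℂ) := by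
    have h := Complex.le_def.1 ((hB r).diag_nonneg (i := j))
    rw [← Complex.ofReal_mul, Real.mul_self_sqrt h.1]
    exact Complex.ext rfl h.2.symm
  rw [h1]
  have ht : star ((√(B r j j).re : ℝ) : ℂ) = ((√(B r j j).re : ℝ) : ℂ) := Complex.conj_ofReal _
  generalize ((√(B r j j).re : ℝ) : ℂ) = t at h2 ht ⊢
  rw [h2, Finset.mul_sum]
  refine Finset.sum_congr rfl fun i _ => ?_
  simp only [star_mul', ht]
  ring

theorem norm_mixing_sq_le (hA : ∀ r, (A r).PosSemidef) (hB : ∀ r, (B r).PosSemidef) {τ : ℝ}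
    (hAτ : ∀ r, ‖A r‖ ≤ τ) (hBτ : ∀ r, ‖B r‖ ≤ τ) (j : Fin n) :
    ‖mixing A B j‖ ^ 2 ≤ K * (τ * τ) := by
  have h := Matrix.l2_opNorm_conjTranspose_mul_self (mixing A B j).conjTranspose
  rw [Matrix.conjTranspose_conjTranspose, Matrix.l2_opNorm_conjTranspose,
    mixing_mul_conjTranspose hA hB] at h
  rw [sq, ← h]
  refine (norm_sum_le _ _).trans ?_
  have : ∀ r ∈ Finset.univ, ‖B r j j • A r‖ ≤ τ * τ := fun r _ => by
    rw [norm_smul]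
    exact mul_le_mul ((norm_entry_le _ _ _).trans (hBτ r)) (hAτ r) (norm_nonneg _)
      ((norm_nonneg _).trans (hBτ r))
  simpa using Finset.sum_le_sum this

section Law

/-! ### Transfer of laws to the product space, and identification of `Qbar`. -/

variable {Ω : Type*} [MeasurableSpace Ω]

/-- The hypotheses on the noise matrices for a fixed dimension. -/
structure Noise (μ : Measure Ω) (Z : Fin K → Ω → Matrix (Fin p) (Fin n) ℂ) (L : ℝ) : Prop where
  nonneg : 0 ≤ L
  measurable : ∀ r i j, Measurable fun ω => Z r ω i j
  indep : iIndepFun (fun (t : Fin K × Fin p × Fin n) (ω : Ω) => Z t.1 ω t.2.1 t.2.2) μ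
  mean : ∀ r i j, ∫ ω, Z r ω i j ∂μ = 0
  var : ∀ r i j, ∫ ω, ‖Z r ω i j‖ ^ 2 ∂μ = 1
  bdd : ∀ r i j, ∀ᵐ ω ∂μ, ‖Z r ω i j‖ ≤ L

/-- Truncation at level `L`. -/
def trunc (L : ℝ) (w : ℂ) : ℂ := if ‖w‖ ≤ L then w else 0

theorem measurable_trunc (L : ℝ) : Measurable (trunc L) :=
  Measurable.ite (measurableSet_le measurable_norm measurable_const) measurable_id measurable_const

/-- The truncated entries, indexed by columns. -/
def entry (Z : Fin K → Ω → Matrix (Fin p) (Fin n) ℂ) (L : ℝ) (j : Fin n) (t : Fin K × Fin p)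
    (ω : Ω) : ℂ :=
  trunc L (Z t.1 ω t.2 j)

variable {μ : Measure Ω} [IsProbabilityMeasure μ] {Z : Fin K → Ω → Matrix (Fin p) (Fin n) ℂ}
  {L : ℝ} {z : ℂ}

namespace Noise

/-- The noise is bounded only almost surely, while `StdEntries` asks for a bound everywhere;
truncation closes the gap without changing mean or variance. -/
theorem entry_ae_eq (h : Noise μ Z L) (j : Fin n) (t : Fin K × Fin p) :
    entry Z L j t =ᵐ[μ] fun ω => Z t.1 ω t.2 j := by
  filter_upwards [h.bdd t.1 t.2 j] with ω hω
  simp [entry, trunc, hω]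

theorem measurable_entry (h : Noise μ Z L) (j : Fin n) (t : Fin K × Fin p) :
    Measurable (entry Z L j t) :=
  (measurable_trunc L).comp (h.measurable t.1 t.2 j)

theorem stdEntries (h : Noise μ Z L) (j : Fin n) : StdEntries μ (entry Z L j) L where
  measurable := h.measurable_entry j
  bound t ω := by
    unfold entry trunc
    split_ifs with hL
    · exact hL
    · simpa using h.nonneg
  mean t := by rw [integral_congr_ae (h.entry_ae_eq j t), h.mean]
  var t := by
    rw [← h.var t.1 t.2 j]
    refine integral_congr_ae ?_
    filter_upwards [h.entry_ae_eq j t] with ω hω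
    rw [hω]

/-- Independence makes the joint law a product, which is reindexed by column and curried.
Efron–Stein can then run on copies of `(Ω, μ)`, one per entry, even though the entries need not be
identically distributed. -/
theorem map_entry (h : Noise μ Z L) :
    μ.map (fun ω j t => entry Z L j t ω) =
      (prodLaw n (Fin K × Fin p) μ).map (fun x j => entryVec (entry Z L j) (x j)) := by
  have hm := h.measurable_entry
  have : ∀ j t, IsProbabilityMeasure (μ.map (entry Z L j t)) := fun j t =>
    Measure.isProbabilityMeasure_map (hm j t).aemeasurable
  have hi : iIndepFun (fun (q : Fin n × (Fin K × Fin p)) ω => entry Z L q.1 q.2 ω) μ := by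
    have h1 := h.indep.comp (fun _ => trunc L) (fun _ => measurable_trunc L)
    have h2 := h1.precomp (g := fun q : Fin n × (Fin K × Fin p) => (q.2.1, q.2.2, q.1))
      (fun a b hab => by
        simp only [Prod.mk.injEq] at hab
        exact Prod.ext hab.2.2 (Prod.ext hab.1 hab.2.1))
    exact h2
  have e1 := hi.map_fun_eq_pi_map
    (fun q : Fin n × (Fin K × Fin p) => (hm q.1 q.2).aemeasurable)
  have e2 := Measure.infinitePi_map_curry (fun j t => μ.map (entry Z L j t))
  simp only [Measure.infinitePi_eq_pi] at e2
  rw [← e1, Measure.map_map (MeasurableEquiv.measurable _)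
    (measurable_pi_lambda _ fun q : Fin n × (Fin K × Fin p) => hm q.1 q.2)] at e2
  have e3 : (prodLaw n (Fin K × Fin p) μ).map (fun x j => entryVec (entry Z L j) (x j)) =
      Measure.pi fun j => Measure.pi fun t => μ.map (entry Z L j t) := by
    have e4 : ∀ j, (Measure.pi fun _ : Fin K × Fin p => μ).map (entryVec (entry Z L j)) =
        Measure.pi fun t => μ.map (entry Z L j t) := fun j =>
      Measure.pi_map_pi fun t => (hm j t).aemeasurable
    have : ∀ j, IsProbabilityMeasure
        ((Measure.pi fun _ : Fin K × Fin p => μ).map (entryVec (entry Z L j))) := fun j => by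
      rw [e4]; infer_instance
    rw [prodLaw, Measure.pi_map_pi]
    · simp only [e4]
    · exact fun j => (measurable_pi_lambda _ fun t =>
        (hm j t).comp (measurable_pi_apply t)).aemeasurable
  rw [e3, ← e2]
  rfl

theorem measurable_dataCols (h : Noise μ Z L) :
    Measurable fun ω => dataCols A B (fun r => Z r ω) := by
  refine measurable_pi_lambda _ fun j => measurable_pi_lambda _ fun k => ?_
  simp only [dataCols, Matrix.mulVec, dotProduct]
  exact Finset.measurable_sum _ fun t _ => (h.measurable t.1 t.2 j).const_mul _

/-- Expectations over the given probability space are expectations over the product space. -/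
theorem integral_dataCols (h : Noise μ Z L) {V : Type*} [NormedAddCommGroup V] [NormedSpace ℝ V]
    [MeasurableSpace V] [BorelSpace V] [SecondCountableTopology V]
    {Φ : (Fin n → Fin p → ℂ) → V} (hΦ : Measurable Φ) :
    ∫ ω, Φ (dataCols A B fun r => Z r ω) ∂μ =
      ∫ x, Φ (cols (mixing A B) (entry Z L) x) ∂(prodLaw n (Fin K × Fin p) μ) := by
  have hψ : Measurable fun (y : Fin n → Fin K × Fin p → ℂ) (j : Fin n) =>
      (mixing A B j).mulVec (y j) := by
    refine measurable_pi_lambda _ fun j => measurable_pi_lambda _ fun k => ?_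
    simp only [Matrix.mulVec, dotProduct]
    fun_prop
  have hm1 : Measurable fun ω j t => entry Z L j t ω :=
    measurable_pi_lambda _ fun j => measurable_pi_lambda _ fun t => h.measurable_entry j t
  have hm2 : Measurable fun (x : Fin n → Fin K × Fin p → Ω) j =>
      entryVec (entry Z L j) (x j) := by
    refine measurable_pi_lambda _ fun j => measurable_pi_lambda _ fun t => ?_
    exact (h.measurable_entry j t).comp ((measurable_pi_apply t).comp (measurable_pi_apply j))
  have e1 := integral_map (μ := μ) hm1.aemeasurable
    (hΦ.comp hψ).aestronglyMeasurable
  have e2 := integral_map (μ := prodLaw n (Fin K × Fin p) μ) hm2.aemeasurable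
    (hΦ.comp hψ).aestronglyMeasurable
  rw [h.map_entry, e2] at e1
  refine Eq.trans ?_ e1.symm
  have hae : ∀ᵐ ω ∂μ, ∀ j t, entry Z L j t ω = Z t.1 ω t.2 j := by
    rw [ae_all_iff]
    intro j
    rw [ae_all_iff]
    exact fun t => h.entry_ae_eq j t
  refine integral_congr_ae ?_
  filter_upwards [hae] with ω hω
  simp only [Function.comp, hω]
  rfl

end Noise

theorem isUnit_sampleCov_sub (hB : ∀ r, (B r).PosSemidef) (hBd : ∀ r, (B r).IsDiag)
    (hz : 0 < z.im) (Z : Fin K → Matrix (Fin p) (Fin n) ℂ) :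
    IsUnit (sampleCov A B Z - z • (1 : Matrix (Fin p) (Fin p) ℂ)) := by
  rw [sampleCov_eq_gram hB hBd]
  exact (isUnit_sub_smul_one (gram_posSemidef _) hz).1

theorem Noise.bddMeas_trace (h : Noise μ Z L) (hz : 0 < z.im) (M : Matrix (Fin p) (Fin p) ℂ) :
    BddMeas fun ω => (res (dataCols A B fun r => Z r ω) z * M).trace :=
  (bddMeas_trace_res hz M).comp h.measurable_dataCols

theorem hStat_eq (hB : ∀ r, (B r).PosSemidef) (hBd : ∀ r, (B r).IsDiag)
    (Z : Fin K → Matrix (Fin p) (Fin n) ℂ) (z : ℂ) (r : Fin K) :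
    hStat A B Z z r = 1 / (p : ℂ) * (res (dataCols A B Z) z * A r).trace := by
  rw [hStat, resolvent_eq_res hB hBd, Matrix.trace_mul_comm]

theorem Noise.integrable_hStat (h : Noise μ Z L) (hB : ∀ r, (B r).PosSemidef)
    (hBd : ∀ r, (B r).IsDiag) (hz : 0 < z.im) (s : Fin K) :
    Integrable (fun ω => hStat A B (fun r => Z r ω) z s) μ := by
  simp only [hStat_eq hB hBd]
  exact ((h.bddMeas_trace hz _).integrable μ).const_mul _

/-- Linearity of the trace in `Γ_j` gives `c_n ∑ s, E h_s · B s j j = E tr(Γ_j Q) / n`, so the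
implicit definition of `Qbar` contains exactly the `meanTrace` of each column. -/
theorem Noise.innerMatrix_eq (h : Noise μ Z L) (hA : ∀ r, (A r).PosSemidef)
    (hB : ∀ r, (B r).PosSemidef) (hBd : ∀ r, (B r).IsDiag) (hz : 0 < z.im) :
    innerMatrix μ A B Z z =
      Matrix.diagonal fun j => 1 + meanTrace μ (mixing A B) (entry Z L) z j := by
  have hmt : ∀ j, meanTrace μ (mixing A B) (entry Z L) z j = (p : ℂ) / (n : ℂ) *
      ∑ s, (∫ ω, hStat A B (fun r => Z r ω) z s ∂μ) * B s j j := fun j => by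
    rw [meanTrace, ← h.integral_dataCols (A := A) (B := B) (continuous_trace_res hz _).measurable,
      mixing_mul_conjTranspose hA hB]
    simp only [Matrix.mul_sum, Matrix.mul_smul, Matrix.trace_sum, Matrix.trace_smul, smul_eq_mul]
    rw [integral_finsetSum _ fun s _ => ((h.bddMeas_trace hz _).integrable μ).const_mul _,
      Finset.mul_sum, Finset.mul_sum]
    refine Finset.sum_congr rfl fun s _ => ?_
    simp only [hStat_eq hB hBd, integral_const_mul]
    -- For `p = 0` the factor `p` does not cancel, but all traces are empty sums.
    rcases Nat.eq_zero_or_pos p with hp | hp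
    · subst hp
      simp [Matrix.trace]
    · have : (p : ℂ) ≠ 0 := by exact_mod_cast hp.ne'
      field_simp
  rw [innerMatrix]
  ext i j
  by_cases hij : i = j
  · subst hij
    simp [Matrix.sum_apply, hmt]
  · have h0 : ∀ s, B s i j = 0 := fun s => hBd s hij
    simp [Matrix.sum_apply, hij, h0]

theorem Noise.isUnit_innerMatrix (h : Noise μ Z L) (hA : ∀ r, (A r).PosSemidef)
    (hB : ∀ r, (B r).PosSemidef) (hBd : ∀ r, (B r).IsDiag) (hz : 0 < z.im) :
    IsUnit (innerMatrix μ A B Z z) := by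
  rw [h.innerMatrix_eq hA hB hBd hz, Matrix.isUnit_diagonal, Pi.isUnit_iff]
  exact fun j => (one_add_ne_zero hz (meanTrace_im_nonneg h.stdEntries hz j).2).isUnit

theorem Noise.outerMatrix_eq (h : Noise μ Z L) (hA : ∀ r, (A r).PosSemidef)
    (hB : ∀ r, (B r).PosSemidef) (hBd : ∀ r, (B r).IsDiag) (hz : 0 < z.im) :
    outerMatrix μ A B Z z =
      outerOf (mixing A B) (fun j => (1 + meanTrace μ (mixing A B) (entry Z L) z j)⁻¹) z := by
  have hinv : (innerMatrix μ A B Z z)⁻¹ =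
      Matrix.diagonal fun j => (1 + meanTrace μ (mixing A B) (entry Z L) z j)⁻¹ := by
    rw [h.innerMatrix_eq hA hB hBd hz]
    refine Matrix.inv_eq_right_inv ?_
    rw [Matrix.diagonal_mul_diagonal, ← Matrix.diagonal_one]
    congr 1
    funext j
    exact mul_inv_cancel₀ (one_add_ne_zero hz (meanTrace_im_nonneg h.stdEntries hz j).2)
  rw [outerMatrix, outerOf, hinv]
  congr 1
  simp only [mixing_mul_conjTranspose hA hB, Matrix.trace, Matrix.diag, Matrix.mul_diagonal,
    Finset.smul_sum, smul_smul, Finset.mul_sum, Finset.sum_smul]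
  rw [Finset.sum_comm]
  refine Finset.sum_congr rfl fun j _ => Finset.sum_congr rfl fun r _ => ?_
  congr 1
  ring

theorem Noise.isUnit_outerMatrix (h : Noise μ Z L) (hA : ∀ r, (A r).PosSemidef)
    (hB : ∀ r, (B r).PosSemidef) (hBd : ∀ r, (B r).IsDiag) (hz : 0 < z.im) :
    IsUnit (outerMatrix μ A B Z z) := by
  rw [h.outerMatrix_eq hA hB hBd hz]
  exact (isUnit_outerOf _ hz fun j =>
    inv_one_add_im_nonpos (meanTrace_im_nonneg h.stdEntries hz j).1).1

theorem Noise.Qbar_eq (h : Noise μ Z L) (hA : ∀ r, (A r).PosSemidef)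
    (hB : ∀ r, (B r).PosSemidef) (hBd : ∀ r, (B r).IsDiag) (hz : 0 < z.im) :
    Qbar μ A B Z z = detEquiv μ (mixing A B) (entry Z L) z := by
  rw [Qbar, h.outerMatrix_eq hA hB hBd hz, detEquiv]

theorem Noise.fourth_moment_le (h : Noise μ Z L) (hz : 0 < z.im)
    (M : Matrix (Fin p) (Fin p) ℂ) :
    ∫ ω, ‖(res (dataCols A B fun r => Z r ω) z * M).trace -
        ∫ ω', (res (dataCols A B fun r => Z r ω') z * M).trace ∂μ‖ ^ 4 ∂μ ≤
      11 * (n : ℝ) ^ 2 * (2 / z.im * ‖M‖) ^ 4 := by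
  have hm := (continuous_trace_res (n := n) hz M).measurable
  rw [h.integral_dataCols (A := A) (B := B) hm]
  have := h.integral_dataCols (A := A) (B := B) (Φ := fun W => ‖(res W z * M).trace -
    ∫ x, (res (cols (mixing A B) (entry Z L) x) z * M).trace
      ∂(prodLaw n (Fin K × Fin p) μ)‖ ^ 4) ((hm.sub_const _).norm.pow_const 4)
  rw [this]
  exact fourth_moment_trace_res_le h.stdEntries hz M

theorem Noise.bias_le (h : Noise μ Z L) (hA : ∀ r, (A r).PosSemidef)
    (hB : ∀ r, (B r).PosSemidef) (hBd : ∀ r, (B r).IsDiag) {τ : ℝ} (hAτ : ∀ r, ‖A r‖ ≤ τ)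
    (hBτ : ∀ r, ‖B r‖ ≤ τ) (hz : 0 < z.im) {κ C : ℝ} (hκ : (K * p : ℝ) ≤ κ * n) (hn : 0 < n)
    (hL : 1 ≤ L) (hLn : L ^ 2 ≤ n) (M : Matrix (Fin p) (Fin p) ℂ) (hM : ‖M‖ ≤ C) :
    ‖∫ ω, (res (dataCols A B fun r => Z r ω) z * M).trace ∂μ - (Qbar μ A B Z z * M).trace‖ ≤
      biasConst (K * (τ * τ)) C z.im ‖z‖ κ * (L * √n) := by
  rw [h.integral_dataCols (A := A) (B := B) (continuous_trace_res hz M).measurable,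
    h.Qbar_eq hA hB hBd hz]
  exact norm_integral_trace_res_sub_le h.stdEntries hz
    (mul_nonneg (Nat.cast_nonneg _) (mul_self_nonneg _))
    (norm_mixing_sq_le hA hB hAτ hBτ) (by simpa using hκ) hn hL hLn M hM

end Law

end Reduction

/-! ### From summable moments to almost sure convergence. -/

section AlmostSure

variable {Ω : Type*} [MeasurableSpace Ω] {μ : Measure Ω}

/-- By Tonelli the tail series has finite expectation, so it converges almost surely and its terms
vanish. No joint law across `n` is involved. -/
theorem ae_tendsto_zero_of_summable {f : ℕ → Ω → ℝ} (hf0 : ∀ n ω, 0 ≤ f n ω)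
    (hf : ∀ n, Integrable (f n) μ) {b : ℕ → ℝ} (hb : Summable b)
    (hle : ∀ᶠ n in atTop, ∫ ω, f n ω ∂μ ≤ b n) :
    ∀ᵐ ω ∂μ, Tendsto (fun n => f n ω) atTop (𝓝 0) := by
  obtain ⟨N, hN⟩ := eventually_atTop.1 hle
  have hs : Summable fun n => ∫ ω, f (n + N) ω ∂μ :=
    Summable.of_nonneg_of_le (fun n => integral_nonneg (hf0 _)) (fun n => hN _ (by omega))
      ((summable_nat_add_iff N).2 hb)
  have hl : ∫⁻ ω, ∑' n, ENNReal.ofReal (f (n + N) ω) ∂μ ≠ ⊤ := by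
    rw [lintegral_tsum fun n => (hf _).1.aemeasurable.ennreal_ofReal]
    simp only [← fun n => ofReal_integral_eq_lintegral_ofReal (hf (n + N))
      (Eventually.of_forall (hf0 (n + N)))]
    rw [← ENNReal.ofReal_tsum_of_nonneg (fun n => integral_nonneg (hf0 _)) hs]
    exact ENNReal.ofReal_ne_top
  have hae := ae_lt_top' (AEMeasurable.tsum fun n =>
    (hf (n + N)).1.aemeasurable.ennreal_ofReal) hl
  filter_upwards [hae] with ω hω
  have h1 := ENNReal.tendsto_atTop_zero_of_tsum_ne_top hω.ne
  have h2 := (ENNReal.tendsto_toReal ENNReal.zero_ne_top).comp h1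
  rw [← tendsto_add_atTop_iff_nat N]
  simpa [Function.comp_def, ENNReal.toReal_ofReal (hf0 _ _)] using h2

theorem tendsto_zero_of_norm_pow_four {u : ℕ → ℂ}
    (h : Tendsto (fun n => ‖u n‖ ^ 4) atTop (𝓝 0)) : Tendsto u atTop (𝓝 0) := by
  rw [tendsto_zero_iff_norm_tendsto_zero]
  have h1 := (Real.continuous_sqrt.comp Real.continuous_sqrt).tendsto (0 : ℝ) |>.comp h
  have e : ∀ n, √√(‖u n‖ ^ 4) = ‖u n‖ := fun n => by
    rw [show ‖u n‖ ^ 4 = (‖u n‖ ^ 2) ^ 2 by ring, Real.sqrt_sq (sq_nonneg _),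
      Real.sqrt_sq (norm_nonneg _)]
  simpa [Function.comp_def, e] using h1

end AlmostSure

end SumSeparable

end

/-! ### The main theorem. -/

theorem theorem4p6 {Ω : Type*} [MeasurableSpace Ω] (μ : Measure Ω) [IsProbabilityMeasure μ]
    (K : ℕ) (p : ℕ → ℕ) (c : ℝ) (hc : 0 < c)
    (hpn : Tendsto (fun n : ℕ => (p n : ℝ) / (n : ℝ)) atTop (𝓝 c))
    (A : (n : ℕ) → Fin K → Matrix (Fin (p n)) (Fin (p n)) ℂ)
    (B : (n : ℕ) → Fin K → Matrix (Fin n) (Fin n) ℂ)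
    (Z : (n : ℕ) → Fin K → Ω → Matrix (Fin (p n)) (Fin n) ℂ)
    (hA : ∀ n r, (A n r).PosSemidef) (hB : ∀ n r, (B n r).PosSemidef)
    (τ : ℝ) (hτ : 0 < τ) (hAτ : ∀ n r, ‖A n r‖ ≤ τ) (hBτ : ∀ n r, ‖B n r‖ ≤ τ)
    (hBdiag : ∀ n r, (B n r).IsDiag)
    (hZmeas : ∀ n r i j, Measurable fun ω => Z n r ω i j)
    (hZindep : ∀ n, iIndepFun
      (fun (t : Fin K × Fin (p n) × Fin n) (ω : Ω) => Z n t.1 ω t.2.1 t.2.2) μ)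
    (hZmean : ∀ n r i j, ∫ ω, Z n r ω i j ∂μ = 0)
    (hZvar : ∀ n r i j, ∫ ω, ‖Z n r ω i j‖ ^ 2 ∂μ = 1)
    (η₀ a : ℝ) (hη₀ : 0 < η₀) (ha : 1 / (4 + η₀) < a) (ha' : a < 1 / 4)
    (hZbdd : ∀ n r i j, ∀ᵐ ω ∂μ, ‖Z n r ω i j‖ ≤ (n : ℝ) ^ a)
    (z : ℂ) (hz : 0 < z.im) :
    -- all the inverses and expectations involved are genuine
    (∀ n ω, IsUnit (SumSeparable.sampleCov (A n) (B n) (fun r => Z n r ω) -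
      z • (1 : Matrix (Fin (p n)) (Fin (p n)) ℂ))) ∧
    (∀ n s, Integrable
      (fun ω => SumSeparable.hStat (A n) (B n) (fun r => Z n r ω) z s) μ) ∧
    (∀ n, IsUnit (SumSeparable.innerMatrix μ (A n) (B n) (Z n) z)) ∧
    (∀ n, IsUnit (SumSeparable.outerMatrix μ (A n) (B n) (Z n) z)) ∧
    -- `Q̄(z)` is a deterministic equivalent of `Q(z)`
    SumSeparable.IsDeterministicEquivalent μ
      (fun n ω => SumSeparable.resolvent (A n) (B n) (fun r => Z n r ω) z)
      (fun n => SumSeparable.Qbar μ (A n) (B n) (Z n) z) := by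
  have hN : ∀ n, SumSeparable.Noise μ (Z n) ((n : ℝ) ^ a) := fun n =>
    ⟨by positivity, hZmeas n, hZindep n, hZmean n, hZvar n, hZbdd n⟩
  have ha0 : 0 < a := lt_trans (by positivity) ha
  refine ⟨fun n ω => SumSeparable.isUnit_sampleCov_sub (hB n) (hBdiag n) hz _,
    fun n s => (hN n).integrable_hStat (hB n) (hBdiag n) hz s,
    fun n => (hN n).isUnit_innerMatrix (hA n) (hB n) (hBdiag n) hz,
    fun n => (hN n).isUnit_outerMatrix (hA n) (hB n) (hBdiag n) hz, ?_⟩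
  rintro M ⟨C, hC⟩
  have hC0 : 0 ≤ C := (norm_nonneg _).trans (hC 0)
  set f : ℕ → Ω → ℂ := fun n ω =>
    (SumSeparable.res (SumSeparable.dataCols (A n) (B n) fun r => Z n r ω) z * M n).trace with hf
  have hfb : ∀ n, SumSeparable.BddMeas (f n) := fun n => (hN n).bddMeas_trace hz (M n)
  -- Eventually `p / n` lies between `c / 2` and `2c`.
  have hev : ∀ᶠ n : ℕ in atTop, 0 < n ∧ 0 < p n ∧ 1 / (p n : ℝ) ≤ 2 / c / n ∧
      (p n : ℝ) ≤ 2 * c * n := by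
    filter_upwards [eventually_gt_atTop 0, hpn.eventually_const_lt (half_lt_self hc),
      hpn.eventually_lt_const (lt_two_mul_self hc)] with n hn h1 h2
    have hn' : (0 : ℝ) < n := by exact_mod_cast hn
    rw [lt_div_iff₀ hn'] at h1
    rw [div_lt_iff₀ hn'] at h2
    have hp : (0 : ℝ) < p n := lt_trans (by positivity) h1
    refine ⟨hn, by exact_mod_cast hp, ?_, h2.le⟩
    rw [div_div, div_le_div_iff₀ hp (by positivity)]
    linarith
  have hconc : ∀ᵐ ω ∂μ, Tendsto (fun n => 1 / (p n : ℂ) * (f n ω - ∫ ω', f n ω' ∂μ)) atTop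
      (𝓝 0) := by
    have hb : ∀ n, SumSeparable.BddMeas fun ω =>
        ‖1 / (p n : ℂ) * (f n ω - ∫ ω', f n ω' ∂μ)‖ ^ 4 := fun n =>
      ((SumSeparable.BddMeas.const _).mul ((hfb n).sub (SumSeparable.BddMeas.const _))).norm.pow 4
    -- The `n²` of the fourth moment against `p⁻⁴ ≤ (2/c)⁴ n⁻⁴`.
    have hs : Summable fun n : ℕ => 11 * (2 / z.im * C) ^ 4 * (2 / c) ^ 4 * (1 / (n : ℝ) ^ 2) :=
      (Real.summable_one_div_nat_pow.2 one_lt_two).mul_left _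
    have := SumSeparable.ae_tendsto_zero_of_summable (fun n ω => by positivity)
      (fun n => (hb n).integrable μ) hs (by
        filter_upwards [hev] with n hn
        obtain ⟨hn0, hp0, hp1, -⟩ := hn
        have hn' : (0 : ℝ) < n := by exact_mod_cast hn0
        simp only [norm_mul, mul_pow]
        rw [integral_const_mul]
        have h4 := (hN n).fourth_moment_le (A := A n) (B := B n) hz (M n)
        have hp : ‖1 / (p n : ℂ)‖ ≤ 2 / c / n := by simpa using hp1
        calc _ ≤ (2 / c / n) ^ 4 * (11 * (n : ℝ) ^ 2 * (2 / z.im * C) ^ 4) := by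
              gcongr
              refine h4.trans ?_
              gcongr
              exact hC n
          _ = _ := by field_simp)
    filter_upwards [this] with ω hω
    exact SumSeparable.tendsto_zero_of_norm_pow_four hω
  have hbias : Tendsto (fun n => 1 / (p n : ℂ) * (∫ ω, f n ω ∂μ -
      (SumSeparable.Qbar μ (A n) (B n) (Z n) z * M n).trace)) atTop (𝓝 0) := by
    set D := SumSeparable.biasConst (K * (τ * τ)) C z.im ‖z‖ (K * (2 * c)) with hD
    -- The bias `O(L√n)` of the trace, with `L = n^a`, divided by `p ≍ n`.
    have hlim : Tendsto (fun n : ℕ => 2 / c * D * (n : ℝ) ^ (-(1 / 2 - a))) atTop (𝓝 0) := by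
      have := ((tendsto_rpow_neg_atTop (y := 1 / 2 - a) (by linarith)).comp
        tendsto_natCast_atTop_atTop).const_mul (2 / c * D)
      simpa [Function.comp_def] using this
    refine squeeze_zero_norm' ?_ hlim
    filter_upwards [hev] with n hn
    obtain ⟨hn0, hp0, hp1, hp2⟩ := hn
    have hn' : (0 : ℝ) < n := by exact_mod_cast hn0
    have hn1 : (1 : ℝ) ≤ n := by exact_mod_cast hn0
    have hκ : (K * p n : ℝ) ≤ K * (2 * c) * n := by
      rw [mul_assoc]
      gcongr
    have hL : (1 : ℝ) ≤ (n : ℝ) ^ a := Real.one_le_rpow hn1 ha0.le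
    have hLn : ((n : ℝ) ^ a) ^ 2 ≤ n := by
      rw [← Real.rpow_natCast, ← Real.rpow_mul hn'.le]
      conv_rhs => rw [← Real.rpow_one (n : ℝ)]
      refine Real.rpow_le_rpow_of_exponent_le hn1 ?_
      push_cast
      linarith
    have hb := (hN n).bias_le (hA n) (hB n) (hBdiag n) (hAτ n) (hBτ n) hz hκ hn0 hL hLn (M n)
      (hC n)
    have hp : ‖1 / (p n : ℂ)‖ ≤ 2 / c / n := by simpa using hp1
    have hpow : (n : ℝ) ^ (-(1 / 2 - a)) = (n : ℝ) ^ a * √n / n := by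
      rw [Real.sqrt_eq_rpow, ← Real.rpow_add hn', ← Real.rpow_sub_one hn'.ne']
      congr 1
      ring
    rw [norm_mul]
    refine (mul_le_mul hp hb (norm_nonneg _) (by positivity)).trans (le_of_eq ?_)
    rw [hpow]
    ring
  filter_upwards [hconc] with ω hω
  have := hω.add hbias
  rw [add_zero] at this
  refine this.congr fun n => ?_
  rw [SumSeparable.resolvent_eq_res (hB n) (hBdiag n), Matrix.sub_mul, Matrix.trace_sub]
  simp only [hf]
  ring
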